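/- Let $K$ be a field. A graded $K$-category is a $K$-linear category $\mathcal C$ with $\operatorname{Hom}_{\mathcal C}(X,Y)=\coprod_{i\in\mathbb Z}\operatorname{Hom}_{\mathcal C}(X,Y)_i$ for all objects $X,Y$, such that composition adds degrees. Its graded radical $\operatorname{rad}_{\mathcal C}$ is the graded ideal whose degree $i$ part consists of the $f\in\operatorname{Hom}_{\mathcal C}(X,Y)_i$ such that $1_X-gf$ is invertible in $\operatorname{End}_{\mathcal C}(X)_0$ for every $g\in\operatorname{Hom}_{\mathcal C}(Y,X)_{-i}$. Let $\operatorname{Gr}(\mathcal C)$ denote the $K$-linear graded functors from $\mathcal C^{\mathrm{op}}$ to $\mathbb Z$-graded $K$-vector spaces, with shift $F[m]_j=F_{m+j}$. Such an $F$ is *linear* if there is an exact sequence with all maps natural of degree zero $$\cdots\to\operatorname{Hom}_{\mathcal C}(-,C_2)[-2]\to\operatorname{Hom}_{\mathcal C}(-,C_1)[-1]\to\operatorname{Hom}_{\mathcal C}(-,C_0)\to F\to 0,\qquad C_i\in\mathcal C .$$ The category $\mathcal C$ is *Koszul* if - $\operatorname{Hom}_{\mathcal C}(X,Y)_i=0$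 for $i<0$, and every $\operatorname{Hom}_{\mathcal C}(X,Y)_i$ is finite dimensional over $K$; - $\mathcal C$ is additive and Krull–Schmidt: finite direct sums exist, and every object is a finite direct sum of objects $Y$ with $\operatorname{End}_{\mathcal C}(Y)_0$ local (all direct sums with structure maps of degree zero); - every simple functor in $\operatorname{Gr}(\mathcal C)$ is linear up to a shift. The *free tensor category* $T(\mathcal C)$ has the same objects as $\mathcal C$ and morphisms $\operatorname{Hom}_{T(\mathcal C)}(X,Y)=\coprod_{n\ge 0}\operatorname{Hom}_{T(\mathcal C)}(X,Y)_n$, where the degree $0$ part is $\operatorname{Hom}_{\mathcal C}(X,Y)/\operatorname{rad}_{\mathcal C}(X,Y)$ and, for $n\ge1$, the degree $n$ part is the value at $(X,Y)$ of the $n$-fold tensor product, over the category $\mathcal C/\operatorname{rad}_{\mathcal C}$, of the bimodule $\operatorname{rad}_{\mathcal C}/\operatorname{rad}^2_{\mathcal C}$. (So it is spanned by tensors $f_n\otimes\cdots\otimes f_1$ with $f_j\in(\operatorname{rad}_{\mathcal C}/\operatorname{rad}_{\mathcal C}^2)(Y_{j-1},Y_j)$, $Y_0=X$, $Y_n=Y$,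 multilinear and subject to $f_{j+1}h\otimes f_j=f_{j+1}\otimes hf_j$ for all morphisms $h$ of $\mathcal C$. For Krull–Schmidt $\mathcal C$ this is the coproduct, over isomorphism classes of indecomposable objects $Y_1,\dots,Y_{n-1}$, of tensor products over $D_{Y_j}=\operatorname{End}_{\mathcal C}(Y_j)/\operatorname{rad}\operatorname{End}_{\mathcal C}(Y_j)$.) Composition is concatenation of tensors, degree $0$ morphisms acting on the outer factors. **Proposition.** Every Koszul $K$-category $\mathcal C$ is quadratic: there is a graded ideal $\mathcal I$ of $T(\mathcal C)$ generated by its degree $2$ component such that $\mathcal C$ and $T(\mathcal C)/\mathcal I$ are equivalent as graded $K$-categories. -/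

import Mathlib

open CategoryTheory Opposite
open scoped DirectSum TensorProduct

universe w v u

namespace KoszulCategory

/-- A `ℤ`-graded `K`-category: every Hom-space is the internal direct sum of its homogeneous
components and composition adds degrees. -/
class GradedCategory (K : Type w) [Field K] (C : Type u) [Category.{v} C] [Preadditive C]
    [Linear K C] where
  deg (X Y : C) : ℤ → Submodule K (X ⟶ Y)
  isInternal (X Y : C) : DirectSum.IsInternal (deg X Y)
  id_mem (X : C) : 𝟙 X ∈ deg X X 0
  comp_mem {X Y Z : C} {i j : ℤ} {f : X ⟶ Y} {g : Y ⟶ Z} :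
    f ∈ deg X Y i → g ∈ deg Y Z j → f ≫ g ∈ deg X Z (i + j)

section Basic

variable (K : Type w) [Field K] {C : Type u} [Category.{v} C] [Preadditive C] [Linear K C]

/-- The degree `i` component `Hom(X, Y)_i`. -/
abbrev homDeg [GradedCategory K C] (X Y : C) (i : ℤ) : Submodule K (X ⟶ Y) :=
  GradedCategory.deg X Y i

variable {K} in
theorem comp_mem_of_eq [GradedCategory K C] {X Y Z : C} {i j k : ℤ} {f : X ⟶ Y} {g : Y ⟶ Z}
    (hf : f ∈ homDeg K X Y i) (hg : g ∈ homDeg K Y Z j) (h : i + j = k) :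
    f ≫ g ∈ homDeg K X Z k :=
  h ▸ GradedCategory.comp_mem hf hg

/-- A criterion for a family of submodules to be an internal direct sum. -/
theorem isInternal_of_proj {M : Type*} [AddCommGroup M] [Module K M] (A : ℤ → Submodule K M)
    (p : ℤ → M →ₗ[K] M) (hp : ∀ i, ∀ x ∈ A i, p i x = x)
    (hp' : ∀ i j, i ≠ j → ∀ x ∈ A j, p i x = 0) (hA : iSup A = ⊤) :
    DirectSum.IsInternal A := by
  refine DirectSum.isInternal_submodule_of_iSupIndep_of_iSup_eq_top ?_ hA
  intro i
  rw [Submodule.disjoint_def]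
  intro x hx hx'
  have h : (⨆ j, ⨆ (_ : j ≠ i), A j) ≤ LinearMap.ker (p i) := by
    refine iSup_le fun j => iSup_le fun hj => ?_
    intro y hy
    exact hp' i j (Ne.symm hj) y hy
  rw [← hp i x hx]
  exact h hx'

/-- A two-sided ideal of a `K`-category, that is, a `K`-linear sub-bifunctor of `Hom`. -/
structure LinearIdeal (K : Type w) [Field K] (C : Type u) [Category.{v} C] [Preadditive C]
    [Linear K C] where
  carrier (X Y : C) : Submodule K (X ⟶ Y)
  precomp_mem {X Y Z : C} (h : X ⟶ Y) {f : Y ⟶ Z} : f ∈ carrier Y Z → h ≫ f ∈ carrier X Z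
  postcomp_mem {X Y Z : C} {f : X ⟶ Y} (h : Y ⟶ Z) : f ∈ carrier X Y → f ≫ h ∈ carrier X Z

/-- The product of two ideals: finite sums of composites `h ∘ g` with `g ∈ J` and `h ∈ I`. -/
def LinearIdeal.mul {K} [Field K] {C : Type u} [Category.{v} C] [Preadditive C] [Linear K C]
    (I J : LinearIdeal K C) : LinearIdeal K C where
  carrier X Y := Submodule.span K
    {f | ∃ (A : C) (g : X ⟶ A) (h : A ⟶ Y), g ∈ J.carrier X A ∧ h ∈ I.carrier A Y ∧ g ≫ h = f}
  precomp_mem {X Y Z} k {f} hf := by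
    induction hf using Submodule.span_induction with
    | mem f hf =>
      obtain ⟨A, g, h, hg, hh, rfl⟩ := hf
      exact Submodule.subset_span
        ⟨A, k ≫ g, h, J.precomp_mem k hg, hh, Category.assoc _ _ _⟩
    | zero => simp
    | add a b _ _ ha hb => rw [Preadditive.comp_add]; exact Submodule.add_mem _ ha hb
    | smul r a _ ha => rw [Linear.comp_smul]; exact Submodule.smul_mem _ _ ha
  postcomp_mem {X Y Z} {f} k hf := by
    induction hf using Submodule.span_induction with
    | mem f hf =>
      obtain ⟨A, g, h, hg, hh, rfl⟩ := hf
      exact Submodule.subset_span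
        ⟨A, g, h ≫ k, hg, I.postcomp_mem k hh, (Category.assoc _ _ _).symm⟩
    | zero => simp
    | add a b _ _ ha hb => rw [Preadditive.add_comp]; exact Submodule.add_mem _ ha hb
    | smul r a _ ha => rw [Linear.smul_comp]; exact Submodule.smul_mem _ _ ha

end Basic

section Radical

variable (K : Type w) [Field K] {C : Type u} [Category.{v} C] [Preadditive C] [Linear K C]
  [GradedCategory K C]

/-- The degree `i` part of the graded radical: all `f : X ⟶ Y` of degree `i` such that
`1 - g ∘ f` is invertible in `End(X)_0` for every `g : Y ⟶ X` of degree `-i`. -/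
def radicalDeg (X Y : C) (i : ℤ) : Submodule K (X ⟶ Y) where
  carrier := {f | f ∈ homDeg K X Y i ∧ ∀ g ∈ homDeg K Y X (-i),
    ∃ u ∈ homDeg K X X 0, u ≫ (𝟙 X - f ≫ g) = 𝟙 X ∧ (𝟙 X - f ≫ g) ≫ u = 𝟙 X}
  zero_mem' := ⟨Submodule.zero_mem _, fun g _ => ⟨𝟙 X, GradedCategory.id_mem X, by simp⟩⟩
  add_mem' := by
    rintro f f' ⟨hf, hf1⟩ ⟨hf', hf1'⟩
    refine ⟨Submodule.add_mem _ hf hf', fun g hg => ?_⟩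
    obtain ⟨u, hu, h1, h2⟩ := hf1 g hg
    obtain ⟨t, ht, h3, h4⟩ := hf1' (g ≫ u) (comp_mem_of_eq hg hu (by ring))
    have key : (𝟙 X - f' ≫ g ≫ u) ≫ (𝟙 X - f ≫ g) = 𝟙 X - (f + f') ≫ g := by
      have : (f' ≫ g ≫ u) ≫ (𝟙 X - f ≫ g) = f' ≫ g := by
        rw [Category.assoc, Category.assoc, h1, Category.comp_id]
      rw [Preadditive.sub_comp, this, Category.id_comp, Preadditive.add_comp]
      abel
    refine ⟨u ≫ t, comp_mem_of_eq hu ht (by ring), ?_, ?_⟩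
    · rw [← key, Category.assoc, reassoc_of% h3, h1]
    · rw [← key, Category.assoc, reassoc_of% h2, h4]
  smul_mem' := by
    rintro c f ⟨hf, hf1⟩
    refine ⟨Submodule.smul_mem _ _ hf, fun g hg => ?_⟩
    obtain ⟨u, hu, h⟩ := hf1 (c • g) (Submodule.smul_mem _ _ hg)
    exact ⟨u, hu, by simpa using h⟩

variable {K} in
theorem precomp_mem_radicalDeg {X Y Z : C} {i j : ℤ} {h : X ⟶ Y} {f : Y ⟶ Z}
    (hh : h ∈ homDeg K X Y j) (hf : f ∈ radicalDeg K Y Z i) :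
    h ≫ f ∈ radicalDeg K X Z (j + i) := by
  refine ⟨comp_mem_of_eq hh hf.1 rfl, fun g hg => ?_⟩
  obtain ⟨u, hu, h1, h2⟩ := hf.2 (g ≫ h) (comp_mem_of_eq hg hh (by ring))
  have h3 : u ≫ f ≫ g ≫ h = u - 𝟙 Y := by
    rw [Preadditive.comp_sub, Category.comp_id] at h1
    rw [← h1]; abel
  have h4 : f ≫ g ≫ h ≫ u = u - 𝟙 Y := by
    rw [Preadditive.sub_comp, Category.id_comp] at h2
    rw [← h2]; simp only [Category.assoc]; abel
  refine ⟨𝟙 X + h ≫ u ≫ f ≫ g, Submodule.add_mem _ (GradedCategory.id_mem X)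
    (comp_mem_of_eq hh (comp_mem_of_eq hu (comp_mem_of_eq hf.1 hg rfl) rfl) (by ring)), ?_, ?_⟩
  · have : (h ≫ u ≫ f ≫ g) ≫ (h ≫ f) ≫ g = h ≫ (u - 𝟙 Y) ≫ f ≫ g := by
      rw [← h3]; simp only [Category.assoc]
    rw [Preadditive.add_comp, Preadditive.comp_sub, Preadditive.comp_sub, this]
    simp
  · have : ((h ≫ f) ≫ g) ≫ (h ≫ u ≫ f ≫ g) = h ≫ (u - 𝟙 Y) ≫ f ≫ g := by
      rw [← h4]; simp only [Category.assoc]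
    rw [Preadditive.comp_add, Preadditive.sub_comp, Preadditive.sub_comp, this]
    simp

variable {K} in
theorem postcomp_mem_radicalDeg {X Y Z : C} {i j : ℤ} {f : X ⟶ Y} {h : Y ⟶ Z}
    (hf : f ∈ radicalDeg K X Y i) (hh : h ∈ homDeg K Y Z j) :
    f ≫ h ∈ radicalDeg K X Z (i + j) := by
  refine ⟨comp_mem_of_eq hf.1 hh rfl, fun g hg => ?_⟩
  obtain ⟨u, hu, h1⟩ := hf.2 (h ≫ g) (comp_mem_of_eq hh hg (by ring))
  exact ⟨u, hu, by simpa using h1⟩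

variable {K} in
theorem hom_induction {X Y : C} {p : (X ⟶ Y) → Prop} (h0 : p 0)
    (hadd : ∀ f g, p f → p g → p (f + g)) (hdeg : ∀ i, ∀ f ∈ homDeg K X Y i, p f)
    (f : X ⟶ Y) : p f := by
  have hf : f ∈ ⨆ i, homDeg K X Y i := by
    rw [(GradedCategory.isInternal (K := K) X Y).submodule_iSup_eq_top]; trivial
  exact Submodule.iSup_induction _ (motive := p) hf hdeg h0 hadd

/-- The (graded) radical `rad_C` of a graded `K`-category. -/
def radical (C : Type u) [Category.{v} C] [Preadditive C] [Linear K C] [GradedCategory K C] :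
    LinearIdeal K C where
  carrier X Y := ⨆ i, radicalDeg K X Y i
  precomp_mem {X Y Z} h {f} hf := by
    refine Submodule.iSup_induction _ (motive := fun f => h ≫ f ∈ ⨆ i, radicalDeg K X Z i)
      hf ?_ (by simp) ?_
    · intro i f hf
      refine hom_induction (K := K) (p := fun h => h ≫ f ∈ ⨆ i, radicalDeg K X Z i)
        (by simp) ?_ ?_ h
      · intro a b ha hb
        rw [Preadditive.add_comp]; exact Submodule.add_mem _ ha hb
      · intro j a ha
        exact Submodule.mem_iSup_of_mem (j + i) (precomp_mem_radicalDeg ha hf)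
    · intro a b ha hb
      rw [Preadditive.comp_add]; exact Submodule.add_mem _ ha hb
  postcomp_mem {X Y Z} {f} h hf := by
    refine Submodule.iSup_induction _ (motive := fun f => f ≫ h ∈ ⨆ i, radicalDeg K X Z i)
      hf ?_ (by simp) ?_
    · intro i f hf
      refine hom_induction (K := K) (p := fun h => f ≫ h ∈ ⨆ i, radicalDeg K X Z i)
        (by simp) ?_ ?_ h
      · intro a b ha hb
        rw [Preadditive.comp_add]; exact Submodule.add_mem _ ha hb
      · intro j a ha
        exact Submodule.mem_iSup_of_mem (i + j) (postcomp_mem_radicalDeg hf ha)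
    · intro a b ha hb
      rw [Preadditive.add_comp]; exact Submodule.add_mem _ ha hb

/-- The square `rad_C²` of the radical. -/
abbrev radicalSq (C : Type u) [Category.{v} C] [Preadditive C] [Linear K C]
    [GradedCategory K C] : LinearIdeal K C :=
  (radical K C).mul (radical K C)

end Radical

section GradedFunctors

variable (K : Type w) [Field K] (C : Type u) [Category.{v} C] [Preadditive C] [Linear K C]
  [GradedCategory K C]

/-- An object of `Gr(C)`: a `K`-linear functor from `Cᵒᵖ` to vector spaces with a `ℤ`-grading on
every value such that a morphism of degree `i` acts as a map of degree `i`. -/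
structure GradedFunctor where
  functor : Cᵒᵖ ⥤ ModuleCat.{v} K
  map_add {X Y : C} (f g : X ⟶ Y) : functor.map (f + g).op = functor.map f.op + functor.map g.op
  map_smul {X Y : C} (c : K) (f : X ⟶ Y) : functor.map (c • f).op = c • functor.map f.op
  deg (X : C) : ℤ → Submodule K (functor.obj (op X))
  isInternal (X : C) : DirectSum.IsInternal (deg X)
  map_mem {X Y : C} {i n : ℤ} {f : X ⟶ Y} {x : functor.obj (op Y)} :
    f ∈ homDeg K X Y i → x ∈ deg Y n → (functor.map f.op).hom x ∈ deg X (n + i)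

variable {K C}

namespace GradedFunctor

/-- The shift `F[m]`, with `F[m]_j = F_{m + j}`. -/
def shift (F : GradedFunctor K C) (m : ℤ) : GradedFunctor K C where
  functor := F.functor
  map_add := F.map_add
  map_smul := F.map_smul
  deg X j := F.deg X (m + j)
  isInternal X := by
    have h := F.isInternal X
    rw [DirectSum.isInternal_submodule_iff_iSupIndep_and_iSup_eq_top] at h ⊢
    exact ⟨h.1.comp (add_right_injective m),
      ((Equiv.addLeft m).iSup_comp (g := F.deg X)).trans h.2⟩
  map_mem {X Y i n f x} hf hx := by
    have := F.map_mem hf hx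
    rwa [add_assoc] at this

/-- The representable graded functor `Hom_C(-, Y)`. -/
def rep (K : Type w) [Field K] {C : Type u} [Category.{v} C] [Preadditive C] [Linear K C]
    [GradedCategory K C] (Y : C) : GradedFunctor K C where
  functor := (linearYoneda K C).obj Y
  map_add f g := by ext x; exact Preadditive.add_comp _ _ _ f g x
  map_smul c f := by ext x; exact Linear.smul_comp _ _ _ c f x
  deg X := homDeg K X Y
  isInternal X := GradedCategory.isInternal X Y
  map_mem hf hx := comp_mem_of_eq hf hx (add_comm _ _)

/-- Morphisms of `Gr(C)_0`: natural transformations all of whose components have degree zero. -/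
structure Hom (F G : GradedFunctor K C) where
  natTrans : F.functor ⟶ G.functor
  map_mem {X : C} {i : ℤ} {x : F.functor.obj (op X)} :
    x ∈ F.deg X i → (natTrans.app (op X)).hom x ∈ G.deg X i

/-- The linear map `F(X) → G(X)` given by a morphism `F → G`. -/
abbrev Hom.app {F G : GradedFunctor K C} (η : Hom F G) (X : C) :
    F.functor.obj (op X) →ₗ[K] G.functor.obj (op X) :=
  (η.natTrans.app (op X)).hom

/-- Graded subfunctors. -/
structure Sub (F : GradedFunctor K C) where
  carrier (X : C) : Submodule K (F.functor.obj (op X))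
  map_mem {X Y : C} (f : X ⟶ Y) {x : F.functor.obj (op Y)} :
    x ∈ carrier Y → (F.functor.map f.op).hom x ∈ carrier X
  homogeneous (X : C) : carrier X ≤ ⨆ i, carrier X ⊓ F.deg X i

/-- `F` is a simple object: it is nonzero and has no graded subfunctors besides `0` and `F`. -/
def IsSimple (F : GradedFunctor K C) : Prop :=
  (∃ (X : C) (x : F.functor.obj (op X)), x ≠ 0) ∧
    ∀ N : F.Sub, (∀ X, N.carrier X = ⊥) ∨ (∀ X, N.carrier X = ⊤)

/-- `F` is linear: there is an exact sequence in `Gr(C)_0`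
`⋯ → Hom(-, P₂)[-2] → Hom(-, P₁)[-1] → Hom(-, P₀) → F → 0`. -/
def IsLinear (F : GradedFunctor K C) : Prop :=
  ∃ (P : ℕ → C)
    (d : ∀ n : ℕ, Hom ((rep K (P (n + 1))).shift (-((n + 1 : ℕ) : ℤ)))
      ((rep K (P n)).shift (-(n : ℤ))))
    (ε : Hom ((rep K (P 0)).shift (-((0 : ℕ) : ℤ))) F),
    ∀ X : C, Function.Surjective (ε.app X) ∧ Function.Exact ((d 0).app X) (ε.app X) ∧
      ∀ n : ℕ, Function.Exact ((d (n + 1)).app X) ((d n).app X)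

end GradedFunctor

end GradedFunctors

section Koszul

variable (K : Type w) [Field K] {C : Type u} [Category.{v} C] [Preadditive C] [Linear K C]
  [GradedCategory K C]

/-- The ring `End(X)_0`. -/
def endZero (X : C) : Subring (End X) where
  carrier := {f | f ∈ homDeg K X X 0}
  mul_mem' {_ _} ha hb := comp_mem_of_eq hb ha (zero_add 0)
  one_mem' := GradedCategory.id_mem X
  add_mem' ha hb := Submodule.add_mem (homDeg K X X 0) ha hb
  zero_mem' := Submodule.zero_mem (homDeg K X X 0)
  neg_mem' ha := Submodule.neg_mem (homDeg K X X 0) ha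

/-- `X` has a graded local endomorphism ring, that is, `End(X)_0` is local. -/
def HasGradedLocalEnd (X : C) : Prop := IsLocalRing (endZero K X)

/-- `X` is the direct sum of the finite family `Y` (with structure maps of degree zero). -/
def IsDirectSum {n : ℕ} (Y : Fin n → C) (X : C) : Prop :=
  ∃ (ι : ∀ a, Y a ⟶ X) (π : ∀ a, X ⟶ Y a),
    (∀ a, ι a ∈ homDeg K (Y a) X 0) ∧ (∀ a, π a ∈ homDeg K X (Y a) 0) ∧
    (∀ a, ι a ≫ π a = 𝟙 (Y a)) ∧ (∀ a b, a ≠ b → ι a ≫ π b = 0) ∧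
    ∑ a, π a ≫ ι a = 𝟙 X

/-- Koszul categories: positively graded, additive, Krull-Schmidt, locally finite graded
`K`-categories such that every simple graded functor is linear up to shift. -/
structure IsKoszul (C : Type u) [Category.{v} C] [Preadditive C] [Linear K C]
    [GradedCategory K C] : Prop where
  positivelyGraded (X Y : C) (i : ℤ) : i < 0 → homDeg K X Y i = ⊥
  locallyFinite (X Y : C) (i : ℤ) : Module.Finite K (homDeg K X Y i)
  exists_directSum {n : ℕ} (Y : Fin n → C) : ∃ X : C, IsDirectSum K Y X
  krullSchmidt (X : C) : ∃ (n : ℕ) (Y : Fin n → C),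
    IsDirectSum K Y X ∧ ∀ a, HasGradedLocalEnd K (Y a)
  isLinear_of_isSimple (S : GradedFunctor K C) : S.IsSimple → ∃ m : ℤ, (S.shift m).IsLinear

end Koszul

noncomputable section Tensor

variable (K : Type w) [Field K] {C : Type u} [Category.{v} C] [Preadditive C] [Linear K C]
  [GradedCategory K C]

/-- The bimodule `rad_C / rad_C²`, evaluated at `(X, Y)`. -/
def RadQuot (X Y : C) : Type v :=
  ((radical K C).carrier X Y) ⧸
    ((radicalSq K C).carrier X Y).submoduleOf ((radical K C).carrier X Y)

namespace RadQuot

instance (X Y : C) : AddCommGroup (RadQuot K X Y) :=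
  inferInstanceAs (AddCommGroup (((radical K C).carrier X Y) ⧸
    ((radicalSq K C).carrier X Y).submoduleOf ((radical K C).carrier X Y)))

instance (X Y : C) : Module K (RadQuot K X Y) :=
  inferInstanceAs (Module K (((radical K C).carrier X Y) ⧸
    ((radicalSq K C).carrier X Y).submoduleOf ((radical K C).carrier X Y)))

/-- The right action of a morphism `h : X ⟶ X'` on `rad / rad²`. -/
def pre {X X' : C} (h : X ⟶ X') (Y : C) : RadQuot K X' Y →ₗ[K] RadQuot K X Y :=
  Submodule.mapQ _ _
    ((Linear.leftComp K Y h).restrict fun _ hf => (radical K C).precomp_mem h hf)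
    fun _ hf => (radicalSq K C).precomp_mem h hf

/-- The left action of a morphism `g : Y ⟶ Y'` on `rad / rad²`. -/
def post (X : C) {Y Y' : C} (g : Y ⟶ Y') : RadQuot K X Y →ₗ[K] RadQuot K X Y' :=
  Submodule.mapQ _ _
    ((Linear.rightComp K X g).restrict fun _ hf => (radical K C).postcomp_mem g hf)
    fun _ hf => (radicalSq K C).postcomp_mem g hf

variable {K} in
/-- The class of a radical morphism in `rad / rad²`. -/
abbrev mk {X Y : C} (f : X ⟶ Y) (hf : f ∈ (radical K C).carrier X Y) : RadQuot K X Y :=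
  Submodule.Quotient.mk ⟨f, hf⟩

theorem ind {X Y : C} {p : RadQuot K X Y → Prop} (h : ∀ f hf, p (mk f hf)) (r) : p r := by
  obtain ⟨⟨f, hf⟩, rfl⟩ := Submodule.Quotient.mk_surjective _ r
  exact h f hf

theorem pre_mk {X X' Y : C} (h : X ⟶ X') (f : X' ⟶ Y) (hf) :
    pre K h Y (mk f hf) = mk (h ≫ f) ((radical K C).precomp_mem h hf) := rfl

theorem post_mk {X Y Y' : C} (g : Y ⟶ Y') (f : X ⟶ Y) (hf) :
    post K X g (mk f hf) = mk (f ≫ g) ((radical K C).postcomp_mem g hf) := rfl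

theorem mk_add {X Y : C} (f g : X ⟶ Y) (hf hg) :
    mk (K := K) (f + g) (Submodule.add_mem _ hf hg) = mk f hf + mk g hg := rfl

theorem mk_smul {X Y : C} (c : K) (f : X ⟶ Y) (hf) :
    mk (K := K) (c • f) (Submodule.smul_mem _ c hf) = c • mk f hf := rfl

theorem mk_congr {X Y : C} {f g : X ⟶ Y} (h : f = g) (hf hg) :
    mk (K := K) f hf = mk g hg := by subst h; rfl

theorem post_id (X Y : C) (r : RadQuot K X Y) : post K X (𝟙 Y) r = r := by
  induction r using ind with
  | h f hf => rw [post_mk]; exact mk_congr K (Category.comp_id f) _ _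

theorem post_comp (X : C) {Y Y' Y'' : C} (g : Y ⟶ Y') (g' : Y' ⟶ Y'') (r : RadQuot K X Y) :
    post K X (g ≫ g') r = post K X g' (post K X g r) := by
  induction r using ind with
  | h f hf => simp only [post_mk]; exact mk_congr K (Category.assoc f g g').symm _ _

theorem post_add (X : C) {Y Y' : C} (g g' : Y ⟶ Y') (r : RadQuot K X Y) :
    post K X (g + g') r = post K X g r + post K X g' r := by
  induction r using ind with
  | h f hf =>
    simp only [post_mk]; rw [← mk_add]; exact mk_congr K (Preadditive.comp_add _ _ _ f g g') _ _

theorem post_smul (X : C) {Y Y' : C} (c : K) (g : Y ⟶ Y') (r : RadQuot K X Y) :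
    post K X (c • g) r = c • post K X g r := by
  induction r using ind with
  | h f hf =>
    simp only [post_mk]; rw [← mk_smul]; exact mk_congr K (Linear.comp_smul _ _ _ f c g) _ _

theorem post_pre {X X' Y Y' : C} (h : X ⟶ X') (g : Y ⟶ Y') (r : RadQuot K X' Y) :
    post K X g (pre K h Y r) = pre K h Y' (post K X' g r) := by
  induction r using ind with
  | h f hf => simp only [post_mk, pre_mk]; exact mk_congr K (Category.assoc h f g) _ _

theorem post_radical (X : C) {Y Y' : C} {g : Y ⟶ Y'} (hg : g ∈ (radical K C).carrier Y Y')
    (r : RadQuot K X Y) : post K X g r = 0 := by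
  induction r using ind with
  | h f hf =>
    rw [post_mk]
    exact (Submodule.Quotient.mk_eq_zero _).2 (Submodule.subset_span ⟨Y, f, g, hf, hg, rfl⟩)

end RadQuot

open Classical in
/-- The relations `r h ⊗ p = r ⊗ h p` for `r ∈ (rad / rad²)(Z', Y)`, `h : Z ⟶ Z'`, `p ∈ P(Z)`. -/
def balanced (P : C ⥤ ModuleCat.{max u v} K) (Y : C) :
    Submodule K (⨁ Z : C, RadQuot K Z Y ⊗[K] P.obj Z) :=
  Submodule.span K
    {x | ∃ (Z Z' : C) (h : Z ⟶ Z') (r : RadQuot K Z' Y) (p : P.obj Z),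
      x = DirectSum.lof K C (fun Z => RadQuot K Z Y ⊗[K] P.obj Z) Z (RadQuot.pre K h Y r ⊗ₜ p) -
        DirectSum.lof K C (fun Z => RadQuot K Z Y ⊗[K] P.obj Z) Z' (r ⊗ₜ (P.map h).hom p)}

/-- The tensor product `(rad / rad²)(-, Y) ⊗_C P` of a contravariant and a covariant functor. If
`rad` kills `P`, it is the tensor product over `C / rad`. If moreover `C` is Krull-Schmidt, it is
the coproduct of `(rad / rad²)(Z, Y) ⊗ P(Z)`, the tensor product being taken over
`D_Z = End(Z) / rad End(Z)`, where `Z` runs through the indecomposable objects up to isomorphism. -/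
abbrev RadTensor (P : C ⥤ ModuleCat.{max u v} K) (Y : C) : Type (max u v) :=
  (⨁ Z : C, RadQuot K Z Y ⊗[K] P.obj Z) ⧸ balanced K P Y

namespace RadTensor

variable {K} (P : C ⥤ ModuleCat.{max u v} K)

/-- The canonical bilinear map `(r, p) ↦ r ⊗ p`. -/
def tmul {Z Y : C} : RadQuot K Z Y →ₗ[K] P.obj Z →ₗ[K] RadTensor K P Y := by
  classical
  exact (TensorProduct.mk K (RadQuot K Z Y) (P.obj Z)).compr₂
    ((balanced K P Y).mkQ ∘ₗ
      DirectSum.lof K C (fun Z => RadQuot K Z Y ⊗[K] P.obj Z) Z)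

theorem tmul_pre {Z Z' Y : C} (h : Z ⟶ Z') (r : RadQuot K Z' Y) (p : P.obj Z) :
    tmul P (RadQuot.pre K h Y r) p = tmul P r ((P.map h).hom p) := by
  classical
  refine (Submodule.Quotient.eq _).2 (Submodule.subset_span ⟨Z, Z', h, r, p, ?_⟩)
  rfl

variable {P} in
theorem ext {Y : C} {M : Type*} [AddCommGroup M] [Module K M] {φ ψ : RadTensor K P Y →ₗ[K] M}
    (h : ∀ (Z : C) (r : RadQuot K Z Y) (p : P.obj Z), φ (tmul P r p) = ψ (tmul P r p)) :
    φ = ψ := by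
  classical
  refine Submodule.linearMap_qext _ (DirectSum.linearMap_ext K fun Z => ?_)
  exact TensorProduct.ext' fun r p => h Z r p

/-- The linear map induced by a balanced family of bilinear maps. -/
def lift {Y : C} {M : Type*} [AddCommGroup M] [Module K M]
    (f : ∀ Z : C, RadQuot K Z Y →ₗ[K] P.obj Z →ₗ[K] M)
    (hf : ∀ (Z Z' : C) (h : Z ⟶ Z') (r : RadQuot K Z' Y) (p : P.obj Z),
      f Z (RadQuot.pre K h Y r) p = f Z' r ((P.map h).hom p)) :
    RadTensor K P Y →ₗ[K] M := by
  classical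
  refine Submodule.liftQ (balanced K P Y)
    (DirectSum.toModule K C M fun Z => TensorProduct.lift (f Z)) ?_
  rw [balanced, Submodule.span_le]
  rintro _ ⟨Z, Z', h, r, p, rfl⟩
  simp [hf]

theorem lift_tmul {Y : C} {M : Type*} [AddCommGroup M] [Module K M]
    (f : ∀ Z : C, RadQuot K Z Y →ₗ[K] P.obj Z →ₗ[K] M) (hf) {Z : C} (r : RadQuot K Z Y)
    (p : P.obj Z) : lift P f hf (tmul P r p) = f Z r p := by
  classical
  change (Submodule.liftQ _ (DirectSum.toModule K C M fun Z => TensorProduct.lift (f Z)) _)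
    (Submodule.Quotient.mk (DirectSum.lof K C (fun Z => RadQuot K Z Y ⊗[K] P.obj Z) Z
      (r ⊗ₜ[K] p))) = f Z r p
  refine (Submodule.liftQ_apply _ _ _).trans ?_
  rw [DirectSum.toModule_lof, TensorProduct.lift.tmul]

/-- The left action of `g : Y ⟶ Y'` on `(rad / rad²) ⊗_C P`. -/
def map {Y Y' : C} (g : Y ⟶ Y') : RadTensor K P Y →ₗ[K] RadTensor K P Y' :=
  lift P (fun Z => (tmul P).comp (RadQuot.post K Z g)) fun Z Z' h r p => by
    simp only [LinearMap.comp_apply]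
    rw [RadQuot.post_pre, tmul_pre]

theorem map_tmul {Z Y Y' : C} (g : Y ⟶ Y') (r : RadQuot K Z Y) (p : P.obj Z) :
    map P g (tmul P r p) = tmul P (RadQuot.post K Z g r) p :=
  lift_tmul P _ _ r p

end RadTensor

/-- The functor `(rad / rad²) ⊗_C P : Y ↦ (rad / rad²)(-, Y) ⊗_C P`. -/
def radTensor (P : C ⥤ ModuleCat.{max u v} K) : C ⥤ ModuleCat.{max u v} K where
  obj Y := ModuleCat.of K (RadTensor K P Y)
  map g := ModuleCat.ofHom (RadTensor.map P g)
  map_id Y := by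
    ext1
    refine RadTensor.ext fun Z r p => ?_
    exact (RadTensor.map_tmul P (𝟙 Y) r p).trans (by rw [RadQuot.post_id]; rfl)
  map_comp g g' := by
    ext1
    refine RadTensor.ext fun Z r p => ?_
    refine (RadTensor.map_tmul P _ r p).trans ?_
    rw [RadQuot.post_comp, ← RadTensor.map_tmul, ← RadTensor.map_tmul]
    rfl

/-- The functor `Hom_C(X, -) / rad_C(X, -)`. -/
def homModRad (X : C) : C ⥤ ModuleCat.{max u v} K where
  obj Y := ModuleCat.of K (ULift.{max u v} ((X ⟶ Y) ⧸ (radical K C).carrier X Y))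
  map {Y Y'} g := ModuleCat.ofHom (ULift.moduleEquiv.symm.toLinearMap ∘ₗ
    Submodule.mapQ _ _ (Linear.rightComp K X g)
      (fun _ hf => (radical K C).postcomp_mem g hf) ∘ₗ ULift.moduleEquiv.toLinearMap)
  map_id Y := by
    ext1
    refine LinearMap.ext ?_
    rintro ⟨x⟩
    obtain ⟨f, rfl⟩ := Submodule.Quotient.mk_surjective _ x
    exact congrArg (fun t => ULift.up (Submodule.Quotient.mk t)) (Category.comp_id f)
  map_comp g g' := by
    ext1
    refine LinearMap.ext ?_
    rintro ⟨x⟩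
    obtain ⟨f, rfl⟩ := Submodule.Quotient.mk_surjective _ x
    exact congrArg (fun t => ULift.up (Submodule.Quotient.mk t)) (Category.assoc f g g').symm

/-- The degree `n` part `Hom_{T(C)}(X, -)_n` of the free tensor category: `Hom_C / rad_C` for
`n = 0`, and the `n`-fold tensor product of `rad_C / rad_C²` over `C / rad_C` for `n ≥ 1`
(recursively `T_{n+1} = (rad_C / rad_C²) ⊗ T_n`, with `M ⊗ (C / rad_C) = M` understood for
`n = 0`). -/
def tensorPow (X : C) : ℕ → (C ⥤ ModuleCat.{max u v} K)
  | 0 => homModRad K X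
  | n + 1 => radTensor K (tensorPow X n)

/-- `Hom_{T(C)}(X, Y) = ⨁ n, Hom_{T(C)}(X, Y)_n`. -/
abbrev TensorHom (X Y : C) : Type (max u v) := ⨁ n : ℕ, (tensorPow K X n).obj Y

variable {K}

/-- The class of a morphism in `Hom_{T(C)}(X, Y)_0 = Hom_C(X, Y) / rad_C(X, Y)`. -/
def ofHom (X Y : C) : (X ⟶ Y) →ₗ[K] (tensorPow K X 0).obj Y :=
  (ULift.moduleEquiv (R := K) (M := (X ⟶ Y) ⧸ (radical K C).carrier X Y)).symm.toLinearMap ∘ₗ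
    ((radical K C).carrier X Y).mkQ

theorem ofHom_surjective (X Y : C) : Function.Surjective (ofHom (K := K) X Y) :=
  (ULift.moduleEquiv (R := K)).symm.surjective.comp (Submodule.mkQ_surjective _)

theorem ofHom_eq_zero {X Y : C} {f : X ⟶ Y} (hf : f ∈ (radical K C).carrier X Y) :
    ofHom (K := K) X Y f = 0 := by
  have : ((radical K C).carrier X Y).mkQ f = 0 := (Submodule.Quotient.mk_eq_zero _).2 hf
  change (ULift.moduleEquiv (R := K)).symm (((radical K C).carrier X Y).mkQ f) = 0
  rw [this, map_zero]

theorem map_ofHom (X : C) {Y Z : C} (f : X ⟶ Y) (g : Y ⟶ Z) :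
    ((tensorPow K X 0).map g).hom (ofHom X Y f) = ofHom X Z (f ≫ g) := rfl

/-- The element `r ⊗ t` of `T_{n+1}` for `r ∈ rad / rad²` and `t ∈ T_n`. -/
def tens (X : C) (n : ℕ) {Y Z : C} :
    RadQuot K Y Z →ₗ[K] (tensorPow K X n).obj Y →ₗ[K] (tensorPow K X (n + 1)).obj Z :=
  RadTensor.tmul (tensorPow K X n)

theorem tens_pre (X : C) (n : ℕ) {Y Y' Z : C} (h : Y ⟶ Y') (r : RadQuot K Y' Z)
    (t : (tensorPow K X n).obj Y) :
    tens X n (RadQuot.pre K h Z r) t = tens X n r (((tensorPow K X n).map h).hom t) :=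
  RadTensor.tmul_pre _ h r t

theorem map_tens (X : C) (n : ℕ) {Y Z Z' : C} (g : Z ⟶ Z') (r : RadQuot K Y Z)
    (t : (tensorPow K X n).obj Y) :
    ((tensorPow K X (n + 1)).map g).hom (tens X n r t) = tens X n (RadQuot.post K Y g r) t :=
  RadTensor.map_tmul _ g r t

theorem tens_ext (X : C) (n : ℕ) {Z : C} {M : Type*} [AddCommGroup M] [Module K M]
    {φ ψ : (tensorPow K X (n + 1)).obj Z →ₗ[K] M}
    (h : ∀ (Y : C) (r : RadQuot K Y Z) (t : (tensorPow K X n).obj Y),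
      φ (tens X n r t) = ψ (tens X n r t)) : φ = ψ :=
  RadTensor.ext h

theorem map_add_tensorPow (X : C) (n : ℕ) {Y Z : C} (g g' : Y ⟶ Z) :
    ((tensorPow K X n).map (g + g')).hom =
      ((tensorPow K X n).map g).hom + ((tensorPow K X n).map g').hom := by
  cases n with
  | zero =>
    ext t
    obtain ⟨f, rfl⟩ := ofHom_surjective X Y t
    rw [LinearMap.add_apply]
    simp only [map_ofHom, Preadditive.comp_add, map_add]
  | succ n =>
    refine tens_ext X n fun W r t => ?_
    rw [LinearMap.add_apply]
    simp only [map_tens, RadQuot.post_add, map_add, LinearMap.add_apply]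

theorem map_smul_tensorPow (X : C) (n : ℕ) {Y Z : C} (c : K) (g : Y ⟶ Z) :
    ((tensorPow K X n).map (c • g)).hom = c • ((tensorPow K X n).map g).hom := by
  cases n with
  | zero =>
    ext t
    obtain ⟨f, rfl⟩ := ofHom_surjective X Y t
    rw [LinearMap.smul_apply]
    simp only [map_ofHom, Linear.comp_smul, map_smul]
  | succ n =>
    refine tens_ext X n fun W r t => ?_
    rw [LinearMap.smul_apply]
    simp only [map_tens, RadQuot.post_smul, map_smul, LinearMap.smul_apply]

theorem map_radical_tensorPow (X : C) (n : ℕ) {Y Z : C} {g : Y ⟶ Z}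
    (hg : g ∈ (radical K C).carrier Y Z) : ((tensorPow K X n).map g).hom = 0 := by
  cases n with
  | zero =>
    ext t
    obtain ⟨f, rfl⟩ := ofHom_surjective X Y t
    rw [map_ofHom, ofHom_eq_zero ((radical K C).precomp_mem f hg)]
    rfl
  | succ n =>
    refine tens_ext X n fun W r t => ?_
    rw [map_tens, RadQuot.post_radical K W hg]
    simp

/-- The left action of morphisms of `C` on `Hom_{T(C)}(X, -)`. -/
def actC (X : C) {Y Z : C} : (Y ⟶ Z) →ₗ[K] TensorHom K X Y →ₗ[K] TensorHom K X Z where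
  toFun g := DirectSum.lmap fun n => ((tensorPow K X n).map g).hom
  map_add' g g' := by
    refine DirectSum.linearMap_ext K fun n => ?_
    ext t
    simp [map_add_tensorPow]
  map_smul' c g := by
    refine DirectSum.linearMap_ext K fun n => ?_
    ext t
    simp [map_smul_tensorPow]

theorem actC_lof (X : C) {Y Z : C} (g : Y ⟶ Z) (n : ℕ) (t : (tensorPow K X n).obj Y) :
    actC X g (DirectSum.lof K ℕ (fun n => (tensorPow K X n).obj Y) n t) =
      DirectSum.lof K ℕ (fun n => (tensorPow K X n).obj Z) n
        (((tensorPow K X n).map g).hom t) := by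
  simp [actC]

theorem actC_id (X Y : C) (s : TensorHom K X Y) : actC X (𝟙 Y) s = s := by
  have : actC (K := K) X (𝟙 Y) = LinearMap.id := by
    refine DirectSum.linearMap_ext K fun n => ?_
    ext t
    simp [actC_lof]
  rw [this]; rfl

theorem actC_comp (X : C) {Y Z W : C} (g : Y ⟶ Z) (h : Z ⟶ W) (s : TensorHom K X Y) :
    actC X (g ≫ h) s = actC X h (actC X g s) := by
  have : actC (K := K) X (g ≫ h) = (actC X h).comp (actC X g) := by
    refine DirectSum.linearMap_ext K fun n => ?_
    ext t
    simp [actC_lof]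
  rw [this]; rfl

/-- The left action of `rad / rad²` on `Hom_{T(C)}(X, -)`, given by `t ↦ r ⊗ t`. -/
def actR (X : C) {Y Z : C} : RadQuot K Y Z →ₗ[K] TensorHom K X Y →ₗ[K] TensorHom K X Z :=
  LinearMap.flip (DirectSum.toModule K ℕ _ fun n =>
    ((tens X n).compr₂ (DirectSum.lof K ℕ (fun n => (tensorPow K X n).obj Z) (n + 1))).flip)

theorem actR_lof (X : C) {Y Z : C} (r : RadQuot K Y Z) (n : ℕ) (t : (tensorPow K X n).obj Y) :
    actR X r (DirectSum.lof K ℕ (fun n => (tensorPow K X n).obj Y) n t) =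
      DirectSum.lof K ℕ (fun n => (tensorPow K X n).obj Z) (n + 1) (tens X n r t) := by
  simp [actR]

theorem actR_pre (X : C) {Y Y' Z : C} (h : Y ⟶ Y') (r : RadQuot K Y' Z) (s : TensorHom K X Y) :
    actR X (RadQuot.pre K h Z r) s = actR X r (actC X h s) := by
  have : actR X (RadQuot.pre K h Z r) = (actR X r).comp (actC X h) := by
    refine DirectSum.linearMap_ext K fun n => ?_
    ext t
    simp [actC_lof, actR_lof, tens_pre]
  rw [this]; rfl

theorem actC_actR (X : C) {Y Z Z' : C} (g : Z ⟶ Z') (r : RadQuot K Y Z) (s : TensorHom K X Y) :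
    actC X g (actR X r s) = actR X (RadQuot.post K Y g r) s := by
  have : (actC X g).comp (actR X r) = actR X (RadQuot.post K Y g r) := by
    refine DirectSum.linearMap_ext K fun n => ?_
    ext t
    simp [actC_lof, actR_lof, map_tens]
  rw [← this]; rfl

/-- The action of `Hom_{T(C)}(Y, Z)_0 = Hom_C(Y, Z) / rad_C(Y, Z)`. -/
def compZero (X Y Z : C) : (tensorPow K Y 0).obj Z →ₗ[K] TensorHom K X Y →ₗ[K] TensorHom K X Z :=
  (Submodule.liftQ ((radical K C).carrier Y Z) (actC X) (by
    intro g hg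
    refine DirectSum.linearMap_ext K fun n => ?_
    ext t
    simp [actC_lof, map_radical_tensorPow X n hg])) ∘ₗ
  (ULift.moduleEquiv (R := K) (M := (Y ⟶ Z) ⧸ (radical K C).carrier Y Z)).toLinearMap

theorem compZero_ofHom (X : C) {Y Z : C} (g : Y ⟶ Z) (s : TensorHom K X Y) :
    compZero X Y Z (ofHom Y Z g) s = actC X g s := rfl

/-- The action of `Hom_{T(C)}(Y, Z)_{m+1}` given by `(r ⊗ t) ∘ s = r ⊗ (t ∘ s)`, where the
(natural) action `φ` of `Hom_{T(C)}(Y, -)_m` has already been defined. -/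
def compSucc (X Y : C) (m : ℕ)
    (φ : ∀ Z : C, (tensorPow K Y m).obj Z →ₗ[K] TensorHom K X Y →ₗ[K] TensorHom K X Z)
    (hφ : ∀ (Z Z' : C) (g : Z ⟶ Z') (t : (tensorPow K Y m).obj Z) (s : TensorHom K X Y),
      φ Z' (((tensorPow K Y m).map g).hom t) s = actC X g (φ Z t s)) (Z : C) :
    (tensorPow K Y (m + 1)).obj Z →ₗ[K] TensorHom K X Y →ₗ[K] TensorHom K X Z :=
  RadTensor.lift (tensorPow K Y m)
    (fun W => (LinearMap.llcomp K _ _ _ ∘ₗ actR X).compl₂ (φ W)) (by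
      intro W W' h r t
      refine LinearMap.ext fun s => ?_
      exact (actR_pre X h r (φ W t s)).trans (congrArg (actR X r) (hφ W W' h t s)).symm)

theorem compSucc_tens (X Y : C) (m : ℕ)
    (φ : ∀ Z : C, (tensorPow K Y m).obj Z →ₗ[K] TensorHom K X Y →ₗ[K] TensorHom K X Z) (hφ)
    {W Z : C} (r : RadQuot K W Z) (t : (tensorPow K Y m).obj W) (s : TensorHom K X Y) :
    compSucc X Y m φ hφ Z (tens Y m r t) s = actR X r (φ W t s) :=
  LinearMap.congr_fun (RadTensor.lift_tmul (tensorPow K Y m) _ _ r t) s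

/-- Composition with elements of `Hom_{T(C)}(Y, -)_m`, by recursion on `m`, together with its
naturality. -/
def compAux (X Y : C) : ∀ m : ℕ,
    {φ : ∀ Z : C, (tensorPow K Y m).obj Z →ₗ[K] TensorHom K X Y →ₗ[K] TensorHom K X Z //
      ∀ (Z Z' : C) (g : Z ⟶ Z') (t : (tensorPow K Y m).obj Z) (s : TensorHom K X Y),
        φ Z' (((tensorPow K Y m).map g).hom t) s = actC X g (φ Z t s)}
  | 0 => ⟨compZero X Y, fun Z Z' g t s => by
      obtain ⟨f, rfl⟩ := ofHom_surjective Y Z t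
      rw [map_ofHom, compZero_ofHom, compZero_ofHom, actC_comp]⟩
  | m + 1 => ⟨compSucc X Y m (compAux X Y m).1 (compAux X Y m).2, fun Z Z' g t s => by
      have : (compSucc X Y m (compAux X Y m).1 (compAux X Y m).2 Z').comp
          ((tensorPow K Y (m + 1)).map g).hom =
          (LinearMap.llcomp K _ _ _ (actC X g)).comp
            (compSucc X Y m (compAux X Y m).1 (compAux X Y m).2 Z) := by
        refine tens_ext Y m fun W r t => ?_
        refine LinearMap.ext fun s => ?_
        rw [LinearMap.comp_apply, LinearMap.comp_apply, map_tens, compSucc_tens,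
          LinearMap.llcomp_apply, compSucc_tens, actC_actR]
      exact LinearMap.congr_fun (LinearMap.congr_fun this t) s⟩

/-- Composition in `T(C)`: `compHom t s = t ∘ s`. -/
def compHom {X Y Z : C} : TensorHom K Y Z →ₗ[K] TensorHom K X Y →ₗ[K] TensorHom K X Z :=
  DirectSum.toModule K ℕ _ fun m => (compAux X Y m).1 Z

theorem compHom_lof_zero {X Y Z : C} (g : Y ⟶ Z) (s : TensorHom K X Y) :
    compHom (DirectSum.lof K ℕ (fun n => (tensorPow K Y n).obj Z) 0 (ofHom Y Z g)) s =
      actC X g s := by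
  rw [compHom, DirectSum.toModule_lof]; rfl

theorem compHom_lof_succ {X Y W Z : C} (m : ℕ) (r : RadQuot K W Z)
    (t : (tensorPow K Y m).obj W) (s : TensorHom K X Y) :
    compHom (DirectSum.lof K ℕ (fun n => (tensorPow K Y n).obj Z) (m + 1) (tens Y m r t)) s =
      actR X r (compHom (DirectSum.lof K ℕ (fun n => (tensorPow K Y n).obj W) m t) s) := by
  rw [compHom, compHom, DirectSum.toModule_lof, DirectSum.toModule_lof]
  exact compSucc_tens X Y m (compAux X Y m).1 (compAux X Y m).2 r t s

/-- Induction principle: morphisms of `T(C)` are sums of iterated tensors. -/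
theorem tensorHom_induction {X : C} (N : ∀ Y : C, Submodule K (TensorHom K X Y))
    (hC : ∀ (Y : C) (g : X ⟶ Y),
      DirectSum.lof K ℕ (fun n => (tensorPow K X n).obj Y) 0 (ofHom X Y g) ∈ N Y)
    (hR : ∀ (Y Z : C) (r : RadQuot K Y Z) (n : ℕ) (t : (tensorPow K X n).obj Y),
      DirectSum.lof K ℕ (fun n => (tensorPow K X n).obj Y) n t ∈ N Y →
      DirectSum.lof K ℕ (fun n => (tensorPow K X n).obj Z) (n + 1) (tens X n r t) ∈ N Z)
    {Y : C} (s : TensorHom K X Y) : s ∈ N Y := by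
  have key : ∀ (n : ℕ) (Y : C) (t : (tensorPow K X n).obj Y),
      DirectSum.lof K ℕ (fun n => (tensorPow K X n).obj Y) n t ∈ N Y := by
    intro n
    induction n with
    | zero =>
      intro Y t
      obtain ⟨g, rfl⟩ := ofHom_surjective X Y t
      exact hC Y g
    | succ n ih =>
      intro Z t
      have h0 : (N Z).mkQ.comp
          (DirectSum.lof K ℕ (fun n => (tensorPow K X n).obj Z) (n + 1)) = 0 := by
        refine tens_ext X n fun Y r s => ?_
        exact (Submodule.Quotient.mk_eq_zero _).2 (hR Y Z r n s (ih Y s))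
      exact (Submodule.Quotient.mk_eq_zero _).1 (LinearMap.congr_fun h0 t)
  induction s using DirectSum.induction_on with
  | zero => exact Submodule.zero_mem _
  | of n t => exact key n Y t
  | add a b ha hb => exact Submodule.add_mem _ ha hb

theorem compHom_actC {X Y Z W : C} (g : Z ⟶ W) (t : TensorHom K Y Z) (s : TensorHom K X Y) :
    compHom (actC Y g t) s = actC X g (compHom t s) := by
  have : (compHom (X := X)).comp (actC Y g) =
      (LinearMap.llcomp K _ _ _ (actC X g)).comp (compHom (K := K) (Y := Y)) := by
    refine DirectSum.linearMap_ext K fun m => ?_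
    refine LinearMap.ext fun t => LinearMap.ext fun s => ?_
    rw [LinearMap.comp_apply, LinearMap.comp_apply, actC_lof, LinearMap.comp_apply,
      LinearMap.comp_apply, LinearMap.llcomp_apply, compHom, compHom, DirectSum.toModule_lof,
      DirectSum.toModule_lof]
    exact (compAux X Y m).2 Z W g t s
  exact LinearMap.congr_fun (LinearMap.congr_fun this t) s

theorem compHom_actR {X Y Z W : C} (r : RadQuot K Z W) (t : TensorHom K Y Z)
    (s : TensorHom K X Y) : compHom (actR Y r t) s = actR X r (compHom t s) := by
  have : (compHom (X := X)).comp (actR Y r) =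
      (LinearMap.llcomp K _ _ _ (actR X r)).comp (compHom (K := K) (Y := Y)) := by
    refine DirectSum.linearMap_ext K fun m => ?_
    refine LinearMap.ext fun t => LinearMap.ext fun s => ?_
    rw [LinearMap.comp_apply, LinearMap.comp_apply, actR_lof, LinearMap.comp_apply,
      LinearMap.comp_apply, LinearMap.llcomp_apply, compHom_lof_succ]
  exact LinearMap.congr_fun (LinearMap.congr_fun this t) s

theorem compHom_assoc {X Y Z W : C} (u : TensorHom K Z W) (t : TensorHom K Y Z)
    (s : TensorHom K X Y) : compHom (compHom u t) s = compHom u (compHom t s) := by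
  refine tensorHom_induction (X := Z) (fun W =>
    { carrier := {u | compHom (compHom u t) s = compHom u (compHom t s)}
      zero_mem' := by simp
      add_mem' := fun {a b} (ha : _ = _) (hb : _ = _) => by
        simp only [Set.mem_ofPred_eq, map_add, LinearMap.add_apply, ha, hb]
      smul_mem' := fun c a (ha : _ = _) => by
        simp only [Set.mem_ofPred_eq, map_smul, LinearMap.smul_apply, ha] }) ?_ ?_ u
  · intro W g
    change compHom (compHom _ t) s = compHom _ (compHom t s)
    rw [compHom_lof_zero, compHom_lof_zero, compHom_actC]
  · intro W W' r n u (hu : compHom (compHom _ t) s = compHom _ (compHom t s))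
    change compHom (compHom _ t) s = compHom _ (compHom t s)
    rw [compHom_lof_succ, compHom_lof_succ, compHom_actR, hu]

/-- The identity of `X` in `T(C)`. -/
def tensorId (X : C) : TensorHom K X X :=
  DirectSum.lof K ℕ (fun n => (tensorPow K X n).obj X) 0 (ofHom X X (𝟙 X))

theorem compHom_tensorId {X Y : C} (t : TensorHom K X Y) : compHom t (tensorId X) = t := by
  refine tensorHom_induction (X := X) (fun Y =>
    { carrier := {t | compHom t (tensorId X) = t}
      zero_mem' := by simp
      add_mem' := fun {a b} (ha : _ = _) (hb : _ = _) => by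
        simp only [Set.mem_ofPred_eq, map_add, LinearMap.add_apply, ha, hb]
      smul_mem' := fun c a (ha : _ = _) => by
        simp only [Set.mem_ofPred_eq, map_smul, LinearMap.smul_apply, ha] }) ?_ ?_ t
  · intro W g
    change compHom _ (tensorId X) = _
    rw [compHom_lof_zero, tensorId, actC_lof, map_ofHom, Category.id_comp]
  · intro W W' r n u (hu : compHom _ (tensorId X) = _)
    change compHom _ (tensorId X) = _
    rw [compHom_lof_succ, hu, actR_lof]

theorem tensorId_compHom {X Y : C} (s : TensorHom K X Y) : compHom (tensorId Y) s = s := by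
  rw [tensorId, compHom_lof_zero, actC_id]

end Tensor

/-- The free tensor category `T(C)`; it has the same objects as `C`. -/
structure FreeTensor (K : Type w) [Field K] (C : Type u) [Category.{v} C] [Preadditive C]
    [Linear K C] [GradedCategory K C] where
  as : C

noncomputable section FreeTensorCategory

variable (K : Type w) [Field K] (C : Type u) [Category.{v} C] [Preadditive C] [Linear K C]
  [GradedCategory K C]

instance : Category.{max u v} (FreeTensor K C) where
  Hom X Y := TensorHom K X.as Y.as
  id X := tensorId X.as
  comp s t := compHom t s
  id_comp t := compHom_tensorId t
  comp_id s := tensorId_compHom s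
  assoc s t u := (compHom_assoc u t s).symm

instance : Preadditive (FreeTensor K C) where
  homGroup X Y := inferInstanceAs (AddCommGroup (TensorHom K X.as Y.as))
  add_comp X Y Z s s' t :=
    (compHom (K := K) (X := X.as) (Y := Y.as) (Z := Z.as) t).map_add s s'
  comp_add X Y Z s t t' := LinearMap.congr_fun
    ((compHom (K := K) (X := X.as) (Y := Y.as) (Z := Z.as)).map_add t t') s

instance : Linear K (FreeTensor K C) where
  homModule X Y := inferInstanceAs (Module K (TensorHom K X.as Y.as))
  smul_comp X Y Z c s t :=
    (compHom (K := K) (X := X.as) (Y := Y.as) (Z := Z.as) t).map_smul c s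
  comp_smul X Y Z s c t := LinearMap.congr_fun
    ((compHom (K := K) (X := X.as) (Y := Y.as) (Z := Z.as)).map_smul c t) s

variable {K C}

/-- The degree `i` part of `Hom_{T(C)}(X, Y)`: the `i`-th summand, and `0` for `i < 0`. -/
def tensorDeg (X Y : C) : ℤ → Submodule K (TensorHom K X Y)
  | Int.ofNat n => LinearMap.range (DirectSum.lof K ℕ (fun n => (tensorPow K X n).obj Y) n)
  | Int.negSucc _ => ⊥

theorem lof_mem_tensorDeg {X Y : C} (n : ℕ) {i : ℤ} (h : (n : ℤ) = i)
    (t : (tensorPow K X n).obj Y) :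
    DirectSum.lof K ℕ (fun n => (tensorPow K X n).obj Y) n t ∈ tensorDeg X Y i := by
  subst h
  exact ⟨t, rfl⟩

theorem compHom_lof_mem {X Y : C} (n : ℕ) (s : (tensorPow K X n).obj Y) (m : ℕ) :
    ∀ (Z : C) (t : (tensorPow K Y m).obj Z),
      compHom (DirectSum.lof K ℕ (fun n => (tensorPow K Y n).obj Z) m t)
        (DirectSum.lof K ℕ (fun n => (tensorPow K X n).obj Y) n s) ∈
      LinearMap.range (DirectSum.lof K ℕ (fun n => (tensorPow K X n).obj Z) (n + m)) := by
  induction m with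
  | zero =>
    intro Z t
    obtain ⟨g, rfl⟩ := ofHom_surjective Y Z t
    rw [compHom_lof_zero, actC_lof]
    exact ⟨_, rfl⟩
  | succ m ih =>
    intro Z t
    have h0 : (LinearMap.range
          (DirectSum.lof K ℕ (fun n => (tensorPow K X n).obj Z) (n + (m + 1)))).mkQ.comp
        ((compHom.flip (DirectSum.lof K ℕ (fun n => (tensorPow K X n).obj Y) n s)).comp
          (DirectSum.lof K ℕ (fun n => (tensorPow K Y n).obj Z) (m + 1))) = 0 := by
      refine tens_ext Y m fun W r t => ?_
      refine (Submodule.Quotient.mk_eq_zero _).2 ?_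
      rw [LinearMap.comp_apply, LinearMap.flip_apply, compHom_lof_succ]
      obtain ⟨u, hu⟩ := ih W t
      rw [← hu, actR_lof]
      exact ⟨_, rfl⟩
    exact (Submodule.Quotient.mk_eq_zero _).1 (LinearMap.congr_fun h0 t)

/-- The projection of `Hom_{T(C)}(X, Y)` onto its degree `i` part. -/
def tensorProj (X Y : C) : ℤ → TensorHom K X Y →ₗ[K] TensorHom K X Y
  | Int.ofNat n => DirectSum.lof K ℕ (fun n => (tensorPow K X n).obj Y) n ∘ₗ
      DirectSum.component K ℕ (fun n => (tensorPow K X n).obj Y) n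
  | Int.negSucc _ => 0

theorem isInternal_tensorDeg (X Y : C) : DirectSum.IsInternal (tensorDeg (K := K) X Y) := by
  refine isInternal_of_proj K _ (tensorProj X Y) ?_ ?_ ?_
  · rintro (n | n) x hx
    · obtain ⟨t, rfl⟩ := hx
      simp [tensorProj]
    · rw [(Submodule.mem_bot K).1 hx, map_zero]
  · rintro (n | n) (m | m) hnm x hx
    · obtain ⟨t, rfl⟩ := hx
      have : m ≠ n := fun h => hnm (by rw [h])
      change DirectSum.lof K ℕ (fun n => (tensorPow K X n).obj Y) n
        (DirectSum.component K ℕ (fun n => (tensorPow K X n).obj Y) n _) = 0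
      rw [DirectSum.component.of, dif_neg this, map_zero]
    · rw [(Submodule.mem_bot K).1 hx, map_zero]
    · rfl
    · rfl
  · rw [eq_top_iff]
    intro s _
    induction s using DirectSum.induction_on with
    | zero => exact Submodule.zero_mem _
    | of n t => exact Submodule.mem_iSup_of_mem (n : ℤ) ⟨t, rfl⟩
    | add a b ha hb => exact Submodule.add_mem _ (ha trivial) (hb trivial)

variable (K C)

instance : GradedCategory K (FreeTensor K C) where
  deg X Y := tensorDeg X.as Y.as
  isInternal X Y := isInternal_tensorDeg X.as Y.as
  id_mem X := ⟨_, rfl⟩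
  comp_mem {X Y Z i j f g} hf hg := by
    rcases i with n | n
    · rcases j with m | m
      · obtain ⟨s, rfl⟩ := hf
        obtain ⟨t, rfl⟩ := hg
        exact compHom_lof_mem n s m Z.as t
      · rw [(Submodule.mem_bot K).1 hg, Limits.comp_zero]
        exact Submodule.zero_mem _
    · rw [(Submodule.mem_bot K).1 hf, Limits.zero_comp]
      exact Submodule.zero_mem _

end FreeTensorCategory

section Quotients

/-- A graded ideal: a graded sub-bifunctor of `Hom`. -/
structure GradedIdeal (K : Type w) [Field K] (C : Type u) [Category.{v} C] [Preadditive C]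
    [Linear K C] [GradedCategory K C] extends LinearIdeal K C where
  homogeneous (X Y : C) : carrier X Y ≤ ⨆ i, carrier X Y ⊓ homDeg K X Y i

variable {K : Type w} [Field K] {C : Type u} [Category.{v} C] [Preadditive C] [Linear K C]

/-- Two morphisms are related if their difference lies in the ideal. -/
def LinearIdeal.rel (I : LinearIdeal K C) : HomRel C :=
  fun X Y f g => f - g ∈ I.carrier X Y

instance (I : LinearIdeal K C) : Congruence I.rel where
  comp_left {_ _ _} f {g g'} h := by
    have := I.precomp_mem f h
    rwa [Preadditive.comp_sub] at this
  comp_right {_ _ _ f f'} g h := by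
    have := I.postcomp_mem g h
    rwa [Preadditive.sub_comp] at this
  equivalence {X Y} :=
    { refl := fun f => by simp [LinearIdeal.rel]
      symm := fun {f g} h => by
        have := Submodule.neg_mem _ h
        rwa [neg_sub] at this
      trans := fun {f g h} h1 h2 => by
        have := Submodule.add_mem _ h1 h2
        rwa [sub_add_sub_cancel] at this }

/-- The quotient category `C / I`. -/
abbrev LinearIdeal.QuotientCategory (I : LinearIdeal K C) := CategoryTheory.Quotient I.rel

namespace LinearIdeal

variable (I : LinearIdeal K C)

theorem rel_add ⦃X Y : C⦄ (f₁ f₂ g₁ g₂ : X ⟶ Y) (h : I.rel f₁ f₂) (h' : I.rel g₁ g₂) :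
    I.rel (f₁ + g₁) (f₂ + g₂) := by
  have := Submodule.add_mem _ h h'
  rwa [sub_add_sub_comm] at this

theorem rel_smul (c : K) ⦃X Y : C⦄ (f₁ f₂ : X ⟶ Y) (h : I.rel f₁ f₂) :
    I.rel (c • f₁) (c • f₂) := by
  have := Submodule.smul_mem _ c h
  rwa [smul_sub] at this

instance : Preadditive I.QuotientCategory := Quotient.preadditive I.rel I.rel_add

instance : (Quotient.functor I.rel).Additive := Quotient.functor_additive I.rel I.rel_add

instance : Linear K I.QuotientCategory := Quotient.linear K I.rel I.rel_smul

instance : (Quotient.functor I.rel).Linear K := Quotient.linear_functor K I.rel I.rel_smul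

end LinearIdeal

variable [GradedCategory K C]

namespace GradedIdeal

variable (I : GradedIdeal K C)

/-- The quotient category `C / I`. -/
abbrev QuotientCategory := I.toLinearIdeal.QuotientCategory

/-- The projection functor `C ⥤ C / I`. -/
abbrev proj : C ⥤ I.QuotientCategory := Quotient.functor I.rel

/-- The degree `i` component of a Hom-space of `C / I`: the image of `Hom_C(X, Y)_i`. -/
def quotientDeg (X Y : I.QuotientCategory) (i : ℤ) : Submodule K (X ⟶ Y) :=
  (homDeg K X.as Y.as i).map (I.proj.mapLinearMap K (X := X.as) (Y := Y.as))

theorem isInternal_quotientDeg (X Y : I.QuotientCategory) :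
    DirectSum.IsInternal (I.quotientDeg X Y) := by
  classical
  let A := homDeg K X.as Y.as
  have hA : DirectSum.IsInternal A := GradedCategory.isInternal X.as Y.as
  let e : (⨁ i, A i) ≃ₗ[K] (X.as ⟶ Y.as) :=
    LinearEquiv.ofBijective (DirectSum.coeLinearMap A) hA
  let p : ℤ → (X.as ⟶ Y.as) →ₗ[K] (X.as ⟶ Y.as) := fun i =>
    (A i).subtype ∘ₗ DirectSum.component K ℤ (fun i => A i) i ∘ₗ e.symm.toLinearMap
  have he : ∀ i (x : A i), e.symm (x : X.as ⟶ Y.as) = DirectSum.lof K ℤ (fun i => A i) i x := by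
    intro i x
    rw [LinearEquiv.symm_apply_eq]
    exact (DirectSum.coeLinearMap_lof A i x).symm
  have hp : ∀ i, ∀ x ∈ A i, p i x = x := by
    intro i x hx
    change ((DirectSum.component K ℤ (fun i => A i) i (e.symm ((⟨x, hx⟩ : A i) : _)) : A i) :
      X.as ⟶ Y.as) = x
    rw [he, DirectSum.component.lof_self]
  have hp' : ∀ i j, i ≠ j → ∀ x ∈ A j, p i x = 0 := by
    intro i j hij x hx
    change ((DirectSum.component K ℤ (fun i => A i) i (e.symm ((⟨x, hx⟩ : A j) : _)) : A i) :
      X.as ⟶ Y.as) = 0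
    rw [he, DirectSum.component.of, dif_neg (Ne.symm hij)]; rfl
  let π : (X.as ⟶ Y.as) →ₗ[K] (X ⟶ Y) := I.proj.mapLinearMap K (X := X.as) (Y := Y.as)
  have hπ : Function.Surjective π := fun f => (Quotient.functor I.rel).map_surjective f
  have hker : ∀ f, π f = 0 ↔ f ∈ I.carrier X.as Y.as := by
    intro f
    rw [← map_zero π]
    refine (Quotient.functor_map_eq_iff I.rel f 0).trans ?_
    rw [LinearIdeal.rel, sub_zero]
  have hpI : ∀ i, ∀ f ∈ I.carrier X.as Y.as, p i f ∈ I.carrier X.as Y.as := by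
    intro i f hf
    refine Submodule.iSup_induction _ (motive := fun f => p i f ∈ I.carrier X.as Y.as)
      (I.homogeneous _ _ hf) ?_ (by simp) ?_
    · intro j x hx
      by_cases hij : i = j
      · subst hij; rw [hp i x hx.2]; exact hx.1
      · rw [hp' i j hij x hx.2]; exact Submodule.zero_mem _
    · intro a b ha hb
      rw [map_add]; exact Submodule.add_mem _ ha hb
  have hle : ∀ i, LinearMap.ker π ≤ LinearMap.ker (π ∘ₗ p i) := by
    intro i f hf
    exact (hker _).2 (hpI i f ((hker f).1 hf))
  let q : ℤ → (X ⟶ Y) →ₗ[K] (X ⟶ Y) := fun i =>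
    ((LinearMap.ker π).liftQ (π ∘ₗ p i) (hle i)) ∘ₗ
      (π.quotKerEquivOfSurjective hπ).symm.toLinearMap
  have hq : ∀ i f, q i (π f) = π (p i f) := by
    intro i f
    have : (π.quotKerEquivOfSurjective hπ).symm (π f) = (LinearMap.ker π).mkQ f := by
      rw [LinearEquiv.symm_apply_eq]; rfl
    change ((LinearMap.ker π).liftQ (π ∘ₗ p i) (hle i))
      ((π.quotKerEquivOfSurjective hπ).symm (π f)) = _
    rw [this]; rfl
  refine isInternal_of_proj K _ q ?_ ?_ ?_
  · rintro i _ ⟨f, hf, rfl⟩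
    exact (hq i f).trans (congrArg π (hp i f hf))
  · rintro i j hij _ ⟨f, hf, rfl⟩
    exact (hq i f).trans ((congrArg π (hp' i j hij f hf)).trans (map_zero π))
  · change (⨆ i, (A i).map π) = ⊤
    rw [← Submodule.map_iSup, hA.submodule_iSup_eq_top, Submodule.map_top]
    exact LinearMap.range_eq_top.2 hπ

instance : GradedCategory K I.QuotientCategory where
  deg := I.quotientDeg
  isInternal := I.isInternal_quotientDeg
  id_mem X := ⟨𝟙 X.as, GradedCategory.id_mem X.as, I.proj.map_id X.as⟩
  comp_mem {X Y Z i j f g} hf hg := by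
    obtain ⟨f, hf, rfl⟩ := hf
    obtain ⟨g, hg, rfl⟩ := hg
    exact ⟨f ≫ g, GradedCategory.comp_mem hf hg, I.proj.map_comp f g⟩

/-- The graded ideal `I` is generated in degree `d`: it is the smallest graded ideal containing
the degree `d` component of `I`. -/
def GeneratedInDegree (d : ℤ) : Prop :=
  ∀ J : GradedIdeal K C,
    (∀ X Y : C, I.carrier X Y ⊓ homDeg K X Y d ≤ J.carrier X Y) →
      ∀ X Y : C, I.carrier X Y ≤ J.carrier X Y

end GradedIdeal

/-- A graded functor: `K`-linear and homogeneous of degree zero on Hom-spaces. -/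
structure IsGradedFunctor (K : Type w) [Field K] {C : Type*} [Category* C] [Preadditive C]
    [Linear K C] [GradedCategory K C] {D : Type*} [Category* D] [Preadditive D] [Linear K D]
    [GradedCategory K D] (F : C ⥤ D) : Prop where
  map_add {X Y : C} (f g : X ⟶ Y) : F.map (f + g) = F.map f + F.map g
  map_smul {X Y : C} (c : K) (f : X ⟶ Y) : F.map (c • f) = c • F.map f
  map_mem {X Y : C} {i : ℤ} {f : X ⟶ Y} :
    f ∈ homDeg K X Y i → F.map f ∈ homDeg K (F.obj X) (F.obj Y) i

/-- `C` and `D` are equivalent as graded `K`-categories: there are mutually quasi-inverse graded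
functors, with natural isomorphisms of degree zero. -/
def GradedEquivalent (K : Type w) [Field K] (C : Type*) [Category* C] [Preadditive C]
    [Linear K C] [GradedCategory K C] (D : Type*) [Category* D] [Preadditive D] [Linear K D]
    [GradedCategory K D] : Prop :=
  ∃ e : C ≌ D, IsGradedFunctor K e.functor ∧ IsGradedFunctor K e.inverse ∧
    (∀ X : C, e.unit.app X ∈ homDeg K X (e.inverse.obj (e.functor.obj X)) 0) ∧
    ∀ Y : D, e.counit.app Y ∈ homDeg K (e.functor.obj (e.inverse.obj Y)) Y 0

end Quotients

end KoszulCategory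

/-! Let `Y` have local degree zero endomorphism ring. The functor `Hom(-, Y) / rad(-, Y)` is simple,
so up to shift it has a linear resolution. Positivity of the grading forces the first term of that
resolution to be isomorphic to `Y` in degree zero. After transport along this isomorphism the
resolution yields degree one morphisms `d₁ : P₂ ⟶ P₁` and `d₀ : P₁ ⟶ Y` with `d₁ ≫ d₀ = 0`, such
that radical morphisms into `Y` factor through `d₀` and morphisms killed by `d₀` factor through
`d₁`. This is `IsKoszul.exists_presentation`, and the rest of the argument rests on it.

Since `d₀` has degree one and negative degrees vanish, a radical morphism has no degree zero
component; Krull-Schmidt decompositions extend this to all targets. Hence `rad` is the positive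
degree part, `rad²` has no degree one component, and taking components of degree 0 and 1 gives maps
out of `Hom / rad` and `rad / rad²`. They extend to a graded functor `IsKoszul.eval` from `T(C)` to
`C`. It is full, by induction on the degree: a morphism of degree `n + 1` into `Y` is `d₀` after a
morphism of degree `n`.

The ideal is the kernel of this functor. A tensor of degree `n + 1` ending at `Y` can be written `d₀
⊗ t'`, because a radical morphism is `d₀ h` and `d₀ h ⊗ t = d₀ ⊗ h t`. If it evaluates to zero, the
value of `t'` is killed by `d₀`, hence (for `n ≥ 1`) is `d₁` after the value of some tensor `s` of
degree `n - 1`. Then `d₀ ⊗ t' = d₀ ⊗ (t' - d₁ ⊗ s) + (d₀ ⊗ d₁) ⊗ s`. The bracket is a relation of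
lower degree, handled by induction, and `d₀ ⊗ d₁` is a quadratic relation. This is
`IsKoszul.lof_mem_of_evalPow_eq_zero`. -/

namespace KoszulCategory

/-! ### Homogeneous components of morphisms -/

noncomputable section Components

variable {K : Type w} [Field K] {C : Type u} [Category.{v} C] [Preadditive C] [Linear K C]
  [GradedCategory K C]

variable (K) in
open Classical in
/-- The projection of `Hom(X, Y)` onto its degree `i` component. -/
def homProj (X Y : C) (i : ℤ) : (X ⟶ Y) →ₗ[K] (X ⟶ Y) :=
  (homDeg K X Y i).subtype ∘ₗ DirectSum.component K ℤ (fun i => homDeg K X Y i) i ∘ₗ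
    (LinearEquiv.ofBijective (DirectSum.coeLinearMap (homDeg K X Y))
      (GradedCategory.isInternal X Y)).symm.toLinearMap

theorem homProj_mem {X Y : C} (i : ℤ) (f : X ⟶ Y) : homProj K X Y i f ∈ homDeg K X Y i :=
  Subtype.coe_prop _

open Classical in
theorem homProj_apply_of_mem {X Y : C} {i j : ℤ} {f : X ⟶ Y} (hf : f ∈ homDeg K X Y j) :
    homProj K X Y i f = if j = i then f else 0 := by
  have he : (LinearEquiv.ofBijective (DirectSum.coeLinearMap (homDeg K X Y))
      (GradedCategory.isInternal X Y)).symm f =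
      DirectSum.lof K ℤ (fun i => homDeg K X Y i) j ⟨f, hf⟩ := by
    rw [LinearEquiv.symm_apply_eq]
    exact (DirectSum.coeLinearMap_lof (homDeg K X Y) j ⟨f, hf⟩).symm
  change ((DirectSum.component K ℤ (fun i => homDeg K X Y i) i
    ((LinearEquiv.ofBijective (DirectSum.coeLinearMap (homDeg K X Y))
      (GradedCategory.isInternal X Y)).symm f) : homDeg K X Y i) : X ⟶ Y) = _
  rw [he]
  split_ifs with h
  · subst h
    rw [DirectSum.component.lof_self]
  · rw [DirectSum.component.of, dif_neg h]
    rfl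

theorem homProj_of_mem {X Y : C} {i : ℤ} {f : X ⟶ Y} (hf : f ∈ homDeg K X Y i) :
    homProj K X Y i f = f := by
  rw [homProj_apply_of_mem hf, if_pos rfl]

theorem homProj_of_mem_of_ne {X Y : C} {i j : ℤ} {f : X ⟶ Y} (hf : f ∈ homDeg K X Y j)
    (h : j ≠ i) : homProj K X Y i f = 0 := by
  rw [homProj_apply_of_mem hf, if_neg h]

/-- Composition with a homogeneous morphism only shifts degrees, so a single component of `f`
contributes. Applied with `i < 0` in a positively graded category, it shows that components of
composites vanish. -/
theorem homProj_comp_of_mem {X Y Z : C} {i j k : ℤ} (f : X ⟶ Y) {g : Y ⟶ Z}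
    (hg : g ∈ homDeg K Y Z j) (h : i + j = k) :
    homProj K X Z k (f ≫ g) = homProj K X Y i f ≫ g := by
  refine hom_induction (K := K)
    (p := fun f => homProj K X Z k (f ≫ g) = homProj K X Y i f ≫ g) (by simp) ?_ ?_ f
  · intro a b ha hb
    simp only [Preadditive.add_comp, map_add, ha, hb]
  · intro l a ha
    rw [homProj_apply_of_mem ha, homProj_apply_of_mem (GradedCategory.comp_mem ha hg)]
    by_cases hl : l = i
    · rw [if_pos hl, if_pos (by omega)]
    · rw [if_neg hl, if_neg (by omega), Limits.zero_comp]

theorem homProj_mem_radicalDeg {X Y : C} {f : X ⟶ Y} (hf : f ∈ (radical K C).carrier X Y)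
    (i : ℤ) : homProj K X Y i f ∈ radicalDeg K X Y i := by
  refine Submodule.iSup_induction _ (motive := fun f => homProj K X Y i f ∈ radicalDeg K X Y i)
    hf ?_ (by simp) ?_
  · intro j a ha
    rw [homProj_apply_of_mem ha.1]
    split_ifs with h
    · exact h ▸ ha
    · exact Submodule.zero_mem _
  · intro a b ha hb
    rw [map_add]
    exact Submodule.add_mem _ ha hb

/-! ### Positively graded categories: degree zero components and the radical -/

variable (K C) in
/-- There are no nonzero morphisms of negative degree. -/
def IsPositivelyGraded : Prop := ∀ (X Y : C) (i : ℤ), i < 0 → homDeg K X Y i = ⊥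

theorem IsKoszul.isPositivelyGraded (hC : IsKoszul K C) : IsPositivelyGraded K C :=
  hC.positivelyGraded

theorem exists_inverse_of_isUnit {X : C} {f : X ⟶ X} (hf : f ∈ homDeg K X X 0)
    (h : IsUnit (⟨f, hf⟩ : endZero K X)) :
    ∃ g ∈ homDeg K X X 0, g ≫ f = 𝟙 X ∧ f ≫ g = 𝟙 X := by
  obtain ⟨g, h1, h2⟩ := isUnit_iff_exists.1 h
  exact ⟨g.1, g.2, congrArg Subtype.val h1, congrArg Subtype.val h2⟩

namespace IsPositivelyGraded

variable (hpos : IsPositivelyGraded K C)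
include hpos

theorem homProj_eq_zero {X Y : C} {i : ℤ} (hi : i < 0) (f : X ⟶ Y) :
    homProj K X Y i f = 0 := by
  have := homProj_mem (K := K) i f
  rwa [hpos X Y i hi, Submodule.mem_bot] at this

/-- Contributions come from components of degrees `-i` and `i`; unless `i = 0`, one of these is
negative and the component vanishes. -/
theorem homProj_zero_comp {X Y Z : C} (f : X ⟶ Y) (g : Y ⟶ Z) :
    homProj K X Z 0 (f ≫ g) = homProj K X Y 0 f ≫ homProj K Y Z 0 g := by
  refine hom_induction (K := K) (p := fun g => homProj K X Z 0 (f ≫ g) =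
    homProj K X Y 0 f ≫ homProj K Y Z 0 g) (by simp) ?_ ?_ g
  · intro a b ha hb
    simp only [Preadditive.comp_add, map_add, ha, hb]
  · intro i a ha
    rw [homProj_comp_of_mem (i := -i) f ha (by ring), homProj_apply_of_mem ha]
    rcases lt_trichotomy i 0 with h | rfl | h
    · rw [hpos _ _ _ h, Submodule.mem_bot] at ha
      simp [ha]
    · simp
    · rw [hpos.homProj_eq_zero (by omega), if_neg (by omega), Limits.zero_comp, Limits.comp_zero]

theorem homProj_one_comp {X Y Z : C} (f : X ⟶ Y) (g : Y ⟶ Z) :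
    homProj K X Z 1 (f ≫ g) = homProj K X Y 0 f ≫ homProj K Y Z 1 g +
      homProj K X Y 1 f ≫ homProj K Y Z 0 g := by
  refine hom_induction (K := K) (p := fun g => homProj K X Z 1 (f ≫ g) =
    homProj K X Y 0 f ≫ homProj K Y Z 1 g + homProj K X Y 1 f ≫ homProj K Y Z 0 g)
    (by simp) ?_ ?_ g
  · intro a b ha hb
    simp only [Preadditive.comp_add, map_add, ha, hb]
    abel
  · intro i a ha
    rw [homProj_comp_of_mem (i := 1 - i) f ha (by ring), homProj_apply_of_mem ha,
      homProj_apply_of_mem ha]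
    obtain h | rfl | rfl | h : i < 0 ∨ i = 0 ∨ i = 1 ∨ 1 < i := by omega
    · rw [hpos _ _ _ h, Submodule.mem_bot] at ha
      simp [ha]
    · simp
    · simp
    · rw [hpos.homProj_eq_zero (by omega), if_neg (by omega), if_neg (by omega)]
      simp

/-- One of the degrees `i` and `-i` is negative, so `f ≫ g = 0` for every test morphism `g`, and the
identity serves as inverse. -/
theorem mem_radical_of_mem {X Y : C} {i : ℤ} (hi : i ≠ 0) {f : X ⟶ Y}
    (hf : f ∈ homDeg K X Y i) : f ∈ (radical K C).carrier X Y := by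
  refine Submodule.mem_iSup_of_mem i ⟨hf, fun g hg => ⟨𝟙 X, GradedCategory.id_mem X, ?_⟩⟩
  have : f ≫ g = 0 := by
    rcases lt_or_gt_of_ne hi with h | h
    · rw [hpos _ _ _ h, Submodule.mem_bot] at hf
      rw [hf, Limits.zero_comp]
    · rw [hpos _ _ _ (by omega), Submodule.mem_bot] at hg
      rw [hg, Limits.comp_zero]
  simp [this]

theorem sub_homProj_zero_mem_radical {X Y : C} (f : X ⟶ Y) :
    f - homProj K X Y 0 f ∈ (radical K C).carrier X Y := by
  refine hom_induction (K := K)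
    (p := fun f => f - homProj K X Y 0 f ∈ (radical K C).carrier X Y) (by simp) ?_ ?_ f
  · intro a b ha hb
    rw [map_add, add_sub_add_comm]
    exact Submodule.add_mem _ ha hb
  · intro i a ha
    rw [homProj_apply_of_mem ha]
    split_ifs with h
    · simp
    · rw [sub_zero]
      exact hpos.mem_radical_of_mem h ha

theorem mem_radical_of_homProj_zero {X Y : C} {f : X ⟶ Y} (hf : homProj K X Y 0 f = 0) :
    f ∈ (radical K C).carrier X Y := by
  have := hpos.sub_homProj_zero_mem_radical f
  rwa [hf, sub_zero] at this

/-! ### The simple functor attached to an object with local endomorphism ring -/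

/-- The functor `Hom(-, Y) / rad(-, Y)`, concentrated in degree zero. -/
def simpleTop (Y : C) : GradedFunctor K C where
  functor :=
    { obj := fun X => ModuleCat.of K ((X.unop ⟶ Y) ⧸ (radical K C).carrier X.unop Y)
      map := fun f => ModuleCat.ofHom (Submodule.mapQ _ _ (Linear.leftComp K Y f.unop)
        (fun _ hg => (radical K C).precomp_mem f.unop hg))
      map_id := fun X => by
        ext1
        refine LinearMap.ext fun x => ?_
        obtain ⟨f, rfl⟩ := Submodule.Quotient.mk_surjective _ x
        exact congrArg Submodule.Quotient.mk (Category.id_comp f)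
      map_comp := fun g g' => by
        ext1
        refine LinearMap.ext fun x => ?_
        obtain ⟨f, rfl⟩ := Submodule.Quotient.mk_surjective _ x
        exact congrArg Submodule.Quotient.mk (Category.assoc g'.unop g.unop f) }
  map_add f g := by
    ext1
    refine LinearMap.ext fun x => ?_
    obtain ⟨h, rfl⟩ := Submodule.Quotient.mk_surjective _ x
    exact congrArg Submodule.Quotient.mk (Preadditive.add_comp _ _ _ f g h)
  map_smul c f := by
    ext1
    refine LinearMap.ext fun x => ?_
    obtain ⟨h, rfl⟩ := Submodule.Quotient.mk_surjective _ x
    exact congrArg Submodule.Quotient.mk (Linear.smul_comp _ _ _ c f h)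
  deg X i := if i = 0 then ⊤ else ⊥
  isInternal X := by
    refine isInternal_of_proj K _ (fun i => if i = 0 then LinearMap.id else 0) ?_ ?_ ?_
    · intro i x hx
      split_ifs at hx ⊢ with h
      · rfl
      · rw [(Submodule.mem_bot K).1 hx, map_zero]
    · intro i j hij x hx
      split_ifs at hx ⊢ with h h'
      · omega
      · rw [(Submodule.mem_bot K).1 hx, map_zero]
      · rfl
      · rfl
    · exact eq_top_iff.2 (le_iSup_of_le 0 (by simp))
  -- Morphisms of nonzero degree are radical, so they act by zero; this is why everything can be
  -- placed in degree zero.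
  map_mem {X Y' i n f x} hf hx := by
    by_cases hn : n = 0
    · by_cases hi : i = 0
      · simp [hn, hi]
      · obtain ⟨g, rfl⟩ := Submodule.Quotient.mk_surjective _ x
        have : (Submodule.Quotient.mk (f ≫ g) : _ ⧸ (radical K C).carrier X Y) = 0 :=
          (Submodule.Quotient.mk_eq_zero _).2
            ((radical K C).postcomp_mem g (hpos.mem_radical_of_mem hi hf))
        exact (congrArg (· ∈ _) this).mpr (Submodule.zero_mem _)
    · rw [if_neg hn, Submodule.mem_bot] at hx
      rw [hx, map_zero]
      exact Submodule.zero_mem _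

/-- The class of a morphism in `Hom(X, Y) / rad(X, Y)`. -/
abbrev simpleTopMk {X Y : C} (f : X ⟶ Y) : (hpos.simpleTop Y).functor.obj (op X) :=
  (Submodule.Quotient.mk f : (X ⟶ Y) ⧸ (radical K C).carrier X Y)

theorem simpleTopMk_surjective {X Y : C} (x : (hpos.simpleTop Y).functor.obj (op X)) :
    ∃ f, hpos.simpleTopMk f = x :=
  Submodule.Quotient.mk_surjective _ x

theorem simpleTopMk_eq_zero {X Y : C} {f : X ⟶ Y} :
    hpos.simpleTopMk f = 0 ↔ f ∈ (radical K C).carrier X Y :=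
  Submodule.Quotient.mk_eq_zero _

theorem simpleTopMk_eq_iff {X Y : C} {f g : X ⟶ Y} :
    hpos.simpleTopMk f = hpos.simpleTopMk g ↔ f - g ∈ (radical K C).carrier X Y :=
  Submodule.Quotient.eq _

theorem simpleTop_map_mk {X X' Y : C} (h : X' ⟶ X) (f : X ⟶ Y) :
    ((hpos.simpleTop Y).functor.map h.op).hom (hpos.simpleTopMk f) =
      hpos.simpleTopMk (h ≫ f) := rfl

/-- A nonzero subfunctor contains the class of a nonradical `f` of degree zero, so `𝟙 X - f ≫ g`
fails to be invertible for some `g`. Then `𝟙 Y - g ≫ f` is not invertible either, and locality makes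
`g ≫ f` a unit. Thus `f` is a split epimorphism and its class generates the functor. -/
theorem isSimple_simpleTop {Y : C} (hY : HasGradedLocalEnd K Y) :
    (hpos.simpleTop Y).IsSimple := by
  have hloc : IsLocalRing (endZero K Y) := hY
  constructor
  · refine ⟨Y, hpos.simpleTopMk (𝟙 Y), fun h => ?_⟩
    rw [simpleTopMk_eq_zero] at h
    have h1 := homProj_mem_radicalDeg h 0
    rw [homProj_of_mem (GradedCategory.id_mem Y)] at h1
    -- Testing radicality of `𝟙 Y` against `𝟙 Y` itself makes the zero endomorphism invertible,
    -- which is impossible in a local ring.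
    obtain ⟨u, -, hu, -⟩ := h1.2 (𝟙 Y) (by simpa using GradedCategory.id_mem (K := K) Y)
    refine one_ne_zero (α := endZero K Y) (Subtype.ext ?_)
    change 𝟙 Y = 0
    rw [← hu]
    simp
  · intro N
    refine or_iff_not_imp_left.2 fun hN => ?_
    push Not at hN
    obtain ⟨X, hX⟩ := hN
    obtain ⟨x, hx, hx0⟩ := (Submodule.ne_bot_iff _).1 hX
    obtain ⟨f', rfl⟩ := hpos.simpleTopMk_surjective x
    obtain ⟨f, hf, hff'⟩ : ∃ f ∈ homDeg K X Y 0, hpos.simpleTopMk f' = hpos.simpleTopMk f :=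
      ⟨_, homProj_mem 0 f', hpos.simpleTopMk_eq_iff.2 (hpos.sub_homProj_zero_mem_radical f')⟩
    rw [hff'] at hx hx0
    have hfr : f ∉ radicalDeg K X Y 0 := fun h =>
      hx0 (hpos.simpleTopMk_eq_zero.2 (Submodule.mem_iSup_of_mem 0 h))
    obtain ⟨g, hg, hgu⟩ : ∃ g ∈ homDeg K Y X 0, ¬ ∃ u ∈ homDeg K X X 0,
        u ≫ (𝟙 X - f ≫ g) = 𝟙 X ∧ (𝟙 X - f ≫ g) ≫ u = 𝟙 X := by
      by_contra h
      exact hfr ⟨hf, fun g hg => by_contra fun h' => h ⟨g, by simpa using hg, h'⟩⟩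
    have hgf : g ≫ f ∈ homDeg K Y Y 0 := comp_mem_of_eq hg hf (add_zero 0)
    obtain ⟨c, -, h1, -⟩ : ∃ c ∈ homDeg K Y Y 0, c ≫ g ≫ f = 𝟙 Y ∧ (g ≫ f) ≫ c = 𝟙 Y := by
      refine exists_inverse_of_isUnit hgf <| (IsLocalRing.isUnit_or_isUnit_of_add_one
        (a := (⟨g ≫ f, hgf⟩ : endZero K Y)) (b := 1 - ⟨g ≫ f, hgf⟩) (by abel)).resolve_right
        fun hu => hgu ?_
      obtain ⟨c, hc, h1, h2⟩ := exists_inverse_of_isUnit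
        (Submodule.sub_mem _ (GradedCategory.id_mem Y) hgf) hu
      have h1' : c ≫ g ≫ f = c - 𝟙 Y := by
        rw [Preadditive.comp_sub, Category.comp_id] at h1
        rw [← h1]; abel
      have h2' : g ≫ f ≫ c = c - 𝟙 Y := by
        rw [Preadditive.sub_comp, Category.id_comp, Category.assoc] at h2
        rw [← h2]; abel
      -- The usual passage from an inverse of `1 - ab` to one of `1 - ba`: here `c` inverts `𝟙 Y - g
      -- ≫ f`.
      refine ⟨𝟙 X + f ≫ c ≫ g, Submodule.add_mem _ (GradedCategory.id_mem X)
        (comp_mem_of_eq hf (comp_mem_of_eq hc hg rfl) (by ring)), ?_, ?_⟩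
      · have : (f ≫ c ≫ g) ≫ f ≫ g = f ≫ (c - 𝟙 Y) ≫ g := by
          rw [← h1']; simp only [Category.assoc]
        rw [Preadditive.add_comp, Preadditive.comp_sub, Preadditive.comp_sub, this]
        simp
      · have : (f ≫ g) ≫ f ≫ c ≫ g = f ≫ (c - 𝟙 Y) ≫ g := by
          rw [← h2']; simp only [Category.assoc]
        rw [Preadditive.sub_comp, Preadditive.comp_add, Preadditive.comp_add, this]
        simp
    intro Z
    rw [eq_top_iff]
    intro z _
    obtain ⟨k, rfl⟩ := hpos.simpleTopMk_surjective z
    have := N.map_mem (k ≫ c ≫ g) hx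
    rw [simpleTop_map_mk] at this
    have h2 : (k ≫ c ≫ g) ≫ f = k := by
      rw [Category.assoc, Category.assoc, h1, Category.comp_id]
    rwa [h2] at this

end IsPositivelyGraded

end Components

/-! ### The first steps of a linear resolution and their consequences for the radical -/

section Resolutions

variable {K : Type w} [Field K] {C : Type u} [Category.{v} C] [Preadditive C] [Linear K C]
  [GradedCategory K C]

namespace GradedFunctor

/-- Yoneda's lemma; the shift changes only the grading, not the underlying functor. -/
theorem Hom.app_rep {P : C} {a : ℤ} {G : GradedFunctor K C} (η : Hom ((rep K P).shift a) G)
    {X : C} (x : X ⟶ P) : η.app X x = (G.functor.map x.op).hom (η.app P (𝟙 P)) := by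
  have h := congrArg (fun t => t.hom (𝟙 P)) (η.natTrans.naturality x.op)
  refine Eq.trans ?_ h
  exact congrArg (η.app X) (Category.comp_id x).symm

theorem Hom.app_rep_rep {P Q : C} {a b : ℤ} (η : Hom ((rep K P).shift a) ((rep K Q).shift b))
    {X : C} (x : X ⟶ P) : η.app X x = x ≫ (show P ⟶ Q from η.app P (𝟙 P)) :=
  η.app_rep x

/-- The identity of `P` lies in degree `-a` of the shifted functor, and degree `-a` of the target is
`Hom(-, Q)` in degree `b - a`. Hence consecutive terms of a linear resolution are joined by
morphisms of degree one. -/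
theorem Hom.app_id_mem {P Q : C} {a b c : ℤ} (η : Hom ((rep K P).shift a) ((rep K Q).shift b))
    (h : b - a = c) : (show P ⟶ Q from η.app P (𝟙 P)) ∈ homDeg K P Q c := by
  have h1 : (show ((rep K P).shift a).functor.obj (op P) from 𝟙 P) ∈
      ((rep K P).shift a).deg P (-a) := by
    change 𝟙 P ∈ homDeg K P P (a + -a)
    rw [add_neg_cancel]
    exact GradedCategory.id_mem P
  have h2 : _ ∈ homDeg K P Q (b + -a) := η.map_mem h1
  rwa [← sub_eq_add_neg, h] at h2

end GradedFunctor

/-- The start of a linear resolution of the simple top of `Hom(-, Y)`: every radical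
morphism to `Y` factors through `d₀`, and `d₁` is a weak kernel of `d₀`. -/
theorem IsKoszul.exists_presentation (hC : IsKoszul K C) {Y : C} (hY : HasGradedLocalEnd K Y) :
    ∃ (P₁ P₂ : C) (d₀ : P₁ ⟶ Y) (d₁ : P₂ ⟶ P₁), d₀ ∈ homDeg K P₁ Y 1 ∧ d₁ ∈ homDeg K P₂ P₁ 1 ∧
      d₁ ≫ d₀ = 0 ∧
      (∀ (X : C) (f : X ⟶ Y), f ∈ (radical K C).carrier X Y → ∃ g, g ≫ d₀ = f) ∧
      ∀ (X : C) (g : X ⟶ P₁), g ≫ d₀ = 0 → ∃ h, h ≫ d₁ = g := by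
  have hpos := hC.isPositivelyGraded
  obtain ⟨m, P, d, ε, hex⟩ := hC.isLinear_of_isSimple _ (hpos.isSimple_simpleTop hY)
  -- By Yoneda `ε` is given by a class modulo the radical. Its representative can be replaced by the
  -- degree zero component, whatever the shift `m` is.
  obtain ⟨f', hf'⟩ := hpos.simpleTopMk_surjective (ε.app (P 0) (𝟙 (P 0)))
  obtain ⟨f₀, hf₀, hff'⟩ : ∃ f ∈ homDeg K (P 0) Y 0, hpos.simpleTopMk f' = hpos.simpleTopMk f :=
    ⟨_, homProj_mem 0 f', hpos.simpleTopMk_eq_iff.2 (hpos.sub_homProj_zero_mem_radical f')⟩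
  have hε : ∀ {X : C} (x : X ⟶ P 0), ε.app X x = hpos.simpleTopMk (x ≫ f₀) := by
    intro X x
    rw [ε.app_rep x, ← hf', hff']
    rfl
  let D₀ : P 1 ⟶ P 0 := (d 0).app (P 1) (𝟙 (P 1))
  let D₁ : P 2 ⟶ P 1 := (d 1).app (P 2) (𝟙 (P 2))
  have hD₀ : D₀ ∈ homDeg K (P 1) (P 0) 1 := (d 0).app_id_mem (by norm_num)
  have hD₁ : D₁ ∈ homDeg K (P 2) (P 1) 1 := (d 1).app_id_mem (by norm_num)
  have hker : ∀ {X : C} (x : X ⟶ P 0), x ≫ f₀ ∈ (radical K C).carrier X Y ↔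
      ∃ y : X ⟶ P 1, y ≫ D₀ = x := by
    intro X x
    rw [← hpos.simpleTopMk_eq_zero, ← hε]
    refine ((hex X).2.1 x).trans ?_
    exact exists_congr fun y => by rw [← (d 0).app_rep_rep y]; rfl
  have hker' : ∀ {X : C} (x : X ⟶ P 1), x ≫ D₀ = 0 ↔ ∃ y : X ⟶ P 2, y ≫ D₁ = x := by
    intro X x
    have h : x ≫ D₀ = (d 0).app X x := ((d 0).app_rep_rep x).symm
    rw [h]
    refine ((hex X).2.2 0 x).trans ?_
    exact exists_congr fun y => by rw [← (d 1).app_rep_rep y]; rfl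
  -- Lift the class of `𝟙 Y` through `ε`. The degree zero component of `𝟙 Y - g' ≫ f₀` is radical,
  -- so the degree zero component of `g' ≫ f₀` is invertible, and `f₀` acquires a section `g₀` of
  -- degree zero.
  obtain ⟨g', hg'⟩ := (hex Y).1 (hpos.simpleTopMk (𝟙 Y))
  change Y ⟶ P 0 at g'
  rw [hε] at hg'
  have hg1 := homProj_mem_radicalDeg (hpos.simpleTopMk_eq_iff.1 hg'.symm) 0
  rw [map_sub, homProj_of_mem (GradedCategory.id_mem Y),
    homProj_comp_of_mem g' hf₀ (add_zero 0)] at hg1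
  obtain ⟨u, hu, hu1, -⟩ := hg1.2 (𝟙 Y) (by simpa using GradedCategory.id_mem (K := K) Y)
  rw [Category.comp_id, sub_sub_cancel, ← Category.assoc] at hu1
  obtain ⟨g₀, hg₀, hgf⟩ : ∃ g₀ ∈ homDeg K Y (P 0) 0, g₀ ≫ f₀ = 𝟙 Y :=
    ⟨_, comp_mem_of_eq hu (homProj_mem 0 g') (add_zero 0), hu1⟩
  -- The difference of the two sides is killed by `f₀`, so it factors through `D₀`. It has degree
  -- zero and `D₀` has degree one, so only the degree `-1` component of the other factor matters,
  -- and that is zero.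
  have hfg : f₀ ≫ g₀ = 𝟙 (P 0) := by
    obtain ⟨y, hy⟩ := (hker (f₀ ≫ g₀ - 𝟙 (P 0))).1 (by
      rw [Preadditive.sub_comp, Category.assoc, hgf]
      simp)
    have h1 : f₀ ≫ g₀ - 𝟙 (P 0) ∈ homDeg K (P 0) (P 0) 0 :=
      Submodule.sub_mem _ (comp_mem_of_eq hf₀ hg₀ (add_zero 0)) (GradedCategory.id_mem _)
    rw [← sub_eq_zero, ← homProj_of_mem h1, ← hy, homProj_comp_of_mem (i := -1) y hD₀ (by ring),
      hpos.homProj_eq_zero (by norm_num), Limits.zero_comp]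
  have hmono : ∀ {X : C} (x : X ⟶ P 0), x ≫ f₀ = 0 → x = 0 := by
    intro X x hx
    rw [← Category.comp_id x, ← hfg, ← Category.assoc, hx, Limits.zero_comp]
  -- With `f₀` an isomorphism of degree zero, the resolution is transported from `P 0` to `Y`.
  refine ⟨P 1, P 2, D₀ ≫ f₀, D₁, comp_mem_of_eq hD₀ hf₀ (add_zero 1), hD₁, ?_, ?_, ?_⟩
  · rw [← Category.assoc, (hker' D₁).2 ⟨𝟙 _, Category.id_comp _⟩, Limits.zero_comp]
  · intro X f hf
    have h1 : (f ≫ g₀) ≫ f₀ = f := by rw [Category.assoc, hgf, Category.comp_id]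
    obtain ⟨y, hy⟩ := (hker (f ≫ g₀)).1 (by rwa [h1])
    exact ⟨y, by rw [← Category.assoc, hy, h1]⟩
  · intro X g hg
    exact (hker' g).1 (hmono _ (by rwa [Category.assoc]))

/-- On each local summand of `Y`, the component of `f` factors through a degree one morphism `d₀`; a
degree zero part would need a factor of degree `-1`. -/
theorem IsKoszul.homProj_zero_of_mem_radical (hC : IsKoszul K C) {X Y : C} {f : X ⟶ Y}
    (hf : f ∈ (radical K C).carrier X Y) : homProj K X Y 0 f = 0 := by
  have hpos := hC.isPositivelyGraded
  obtain ⟨n, Y', ⟨ι, π, -, hπ, -, -, hsum⟩, hloc⟩ := hC.krullSchmidt Y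
  have key : ∀ a, homProj K X Y 0 f ≫ π a = 0 := by
    intro a
    obtain ⟨P₁, -, d₀, -, hd₀, -, -, h, -⟩ := hC.exists_presentation (hloc a)
    obtain ⟨g, hg⟩ := h X (f ≫ π a) ((radical K C).postcomp_mem _ hf)
    rw [← homProj_comp_of_mem f (hπ a) (add_zero 0), ← hg,
      homProj_comp_of_mem (i := -1) g hd₀ (by ring), hpos.homProj_eq_zero (by norm_num),
      Limits.zero_comp]
  rw [← Category.comp_id (homProj K X Y 0 f), ← hsum, Preadditive.comp_sum]
  exact Finset.sum_eq_zero fun a _ => by rw [← Category.assoc, key, Limits.zero_comp]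

/-- In a composite of two morphisms, each degree one contribution involves a degree zero component
of one factor, and radical factors have none. -/
theorem IsKoszul.homProj_one_of_mem_radicalSq (hC : IsKoszul K C) {X Y : C} {f : X ⟶ Y}
    (hf : f ∈ (radicalSq K C).carrier X Y) : homProj K X Y 1 f = 0 := by
  induction hf using Submodule.span_induction with
  | mem f hf =>
    obtain ⟨A, g, h, hg, hh, rfl⟩ := hf
    rw [hC.isPositivelyGraded.homProj_one_comp, hC.homProj_zero_of_mem_radical hg,
      hC.homProj_zero_of_mem_radical hh, Limits.zero_comp, Limits.comp_zero, add_zero]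
  | zero => simp
  | add a b _ _ ha hb => rw [map_add, ha, hb, add_zero]
  | smul r a _ ha => rw [map_smul, ha, smul_zero]

end Resolutions

/-! ### The evaluation functor from the free tensor category and its kernel -/

noncomputable section Evaluation

variable {K : Type w} [Field K] {C : Type u} [Category.{v} C] [Preadditive C] [Linear K C]
  [GradedCategory K C]

namespace IsKoszul

variable (hC : IsKoszul K C)

include hC in
theorem mem_radical_iff {X Y : C} {f : X ⟶ Y} :
    f ∈ (radical K C).carrier X Y ↔ homProj K X Y 0 f = 0 :=
  ⟨hC.homProj_zero_of_mem_radical, hC.isPositivelyGraded.mem_radical_of_homProj_zero⟩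

/-- The map `rad / rad² → Hom` sending the class of `f` to the degree one component of `f`. -/
def evalRadQuot (X Y : C) : RadQuot K X Y →ₗ[K] (X ⟶ Y) :=
  Submodule.liftQ _ (homProj K X Y 1 ∘ₗ ((radical K C).carrier X Y).subtype)
    fun _ hf => hC.homProj_one_of_mem_radicalSq hf

theorem evalRadQuot_mk {X Y : C} (f : X ⟶ Y) (hf) :
    hC.evalRadQuot X Y (RadQuot.mk f hf) = homProj K X Y 1 f := rfl

/-- A radical morphism has no degree zero component, so only one of the two terms of
`homProj_one_comp` survives. This is the balancing condition that lets evaluation descend to tensor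
products. -/
theorem evalRadQuot_pre {X X' Y : C} (h : X ⟶ X') (r : RadQuot K X' Y) :
    hC.evalRadQuot X Y (RadQuot.pre K h Y r) = homProj K X X' 0 h ≫ hC.evalRadQuot X' Y r := by
  induction r using RadQuot.ind with
  | h f hf =>
    rw [RadQuot.pre_mk, evalRadQuot_mk, evalRadQuot_mk, hC.isPositivelyGraded.homProj_one_comp,
      hC.mem_radical_iff.1 hf, Limits.comp_zero, add_zero]

theorem evalRadQuot_post {X Y Y' : C} (g : Y ⟶ Y') (r : RadQuot K X Y) :
    hC.evalRadQuot X Y' (RadQuot.post K X g r) = hC.evalRadQuot X Y r ≫ homProj K Y Y' 0 g := by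
  induction r using RadQuot.ind with
  | h f hf =>
    rw [RadQuot.post_mk, evalRadQuot_mk, evalRadQuot_mk, hC.isPositivelyGraded.homProj_one_comp,
      hC.mem_radical_iff.1 hf, Limits.zero_comp, zero_add]

theorem evalRadQuot_mem {X Y : C} (r : RadQuot K X Y) :
    hC.evalRadQuot X Y r ∈ homDeg K X Y 1 := by
  induction r using RadQuot.ind with
  | h f hf => exact homProj_mem 1 f

/-- The degree zero part of the evaluation `T(C) ⥤ C`. -/
def evalZero (X Y : C) : (tensorPow K X 0).obj Y →ₗ[K] (X ⟶ Y) :=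
  Submodule.liftQ _ (homProj K X Y 0) (fun _ hf => hC.homProj_zero_of_mem_radical hf) ∘ₗ
    (ULift.moduleEquiv (R := K) (M := (X ⟶ Y) ⧸ (radical K C).carrier X Y)).toLinearMap

theorem evalZero_ofHom {X Y : C} (f : X ⟶ Y) :
    hC.evalZero X Y (ofHom X Y f) = homProj K X Y 0 f := rfl

/-- The step `r ⊗ t ↦ r ∘ t` of the evaluation `T(C) ⥤ C`. -/
def evalSucc (X : C) (n : ℕ) (φ : ∀ Y : C, (tensorPow K X n).obj Y →ₗ[K] (X ⟶ Y))
    (hφ : ∀ (Y Z : C) (g : Y ⟶ Z) (t : (tensorPow K X n).obj Y),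
      φ Z (((tensorPow K X n).map g).hom t) = φ Y t ≫ homProj K Y Z 0 g) (Z : C) :
    (tensorPow K X (n + 1)).obj Z →ₗ[K] (X ⟶ Z) :=
  RadTensor.lift (tensorPow K X n)
    (fun Y => (((Linear.comp X Y Z).flip).comp (hC.evalRadQuot Y Z)).compl₂ (φ Y)) (by
      intro Y Y' h r t
      change φ Y t ≫ hC.evalRadQuot Y Z _ = φ Y' _ ≫ hC.evalRadQuot Y' Z r
      rw [evalRadQuot_pre, hφ, Category.assoc])

theorem evalSucc_tens (X : C) (n : ℕ) (φ : ∀ Y : C, (tensorPow K X n).obj Y →ₗ[K] (X ⟶ Y))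
    (hφ) {Y Z : C} (r : RadQuot K Y Z) (t : (tensorPow K X n).obj Y) :
    hC.evalSucc X n φ hφ Z (tens X n r t) = φ Y t ≫ hC.evalRadQuot Y Z r :=
  RadTensor.lift_tmul (tensorPow K X n) _ _ r t

/-- The degree `n` part of the evaluation `T(C) ⥤ C`, together with its naturality. -/
def evalAux (X : C) : ∀ n : ℕ,
    {φ : ∀ Y : C, (tensorPow K X n).obj Y →ₗ[K] (X ⟶ Y) //
      ∀ (Y Z : C) (g : Y ⟶ Z) (t : (tensorPow K X n).obj Y),
        φ Z (((tensorPow K X n).map g).hom t) = φ Y t ≫ homProj K Y Z 0 g}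
  | 0 => ⟨hC.evalZero X, fun Y Z g t => by
      obtain ⟨f, rfl⟩ := ofHom_surjective X Y t
      rw [map_ofHom, evalZero_ofHom, evalZero_ofHom, hC.isPositivelyGraded.homProj_zero_comp]⟩
  | n + 1 => ⟨hC.evalSucc X n (evalAux X n).1 (evalAux X n).2, fun Y Z g t => by
      have : (hC.evalSucc X n (evalAux X n).1 (evalAux X n).2 Z).comp
          ((tensorPow K X (n + 1)).map g).hom =
          (Linear.rightComp K X (homProj K Y Z 0 g)).comp
            (hC.evalSucc X n (evalAux X n).1 (evalAux X n).2 Y) := by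
        refine tens_ext X n fun W r t => ?_
        rw [LinearMap.comp_apply, LinearMap.comp_apply, map_tens, evalSucc_tens, evalSucc_tens,
          Linear.rightComp_apply, evalRadQuot_post, Category.assoc]
      exact LinearMap.congr_fun this t⟩

/-- The degree `n` part of the evaluation `T(C) ⥤ C`. -/
def evalPow (X : C) (n : ℕ) (Y : C) : (tensorPow K X n).obj Y →ₗ[K] (X ⟶ Y) :=
  (hC.evalAux X n).1 Y

theorem evalPow_map (X : C) (n : ℕ) {Y Z : C} (g : Y ⟶ Z) (t : (tensorPow K X n).obj Y) :
    hC.evalPow X n Z (((tensorPow K X n).map g).hom t) =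
      hC.evalPow X n Y t ≫ homProj K Y Z 0 g :=
  (hC.evalAux X n).2 Y Z g t

theorem evalPow_ofHom {X Y : C} (f : X ⟶ Y) :
    hC.evalPow X 0 Y (ofHom X Y f) = homProj K X Y 0 f := rfl

theorem evalPow_tens (X : C) (n : ℕ) {Y Z : C} (r : RadQuot K Y Z)
    (t : (tensorPow K X n).obj Y) :
    hC.evalPow X (n + 1) Z (tens X n r t) = hC.evalPow X n Y t ≫ hC.evalRadQuot Y Z r :=
  hC.evalSucc_tens X n _ (hC.evalAux X n).2 r t

theorem evalPow_mem (X : C) (n : ℕ) {Y : C} (t : (tensorPow K X n).obj Y) :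
    hC.evalPow X n Y t ∈ homDeg K X Y n := by
  induction n generalizing Y with
  | zero =>
    obtain ⟨f, rfl⟩ := ofHom_surjective X Y t
    exact homProj_mem 0 f
  | succ n ih =>
    have h0 : (homDeg K X Y (n + 1 : ℕ)).mkQ.comp (hC.evalPow X (n + 1) Y) = 0 := by
      refine tens_ext X n fun Z r s => (Submodule.Quotient.mk_eq_zero _).2 ?_
      rw [evalPow_tens]
      exact comp_mem_of_eq (ih s) (hC.evalRadQuot_mem r) (by push_cast; rfl)
    exact (Submodule.Quotient.mk_eq_zero _).1 (LinearMap.congr_fun h0 t)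

/-- The evaluation `T(C) ⥤ C` on morphisms. -/
def evalHom (X Y : C) : TensorHom K X Y →ₗ[K] (X ⟶ Y) :=
  DirectSum.toModule K ℕ _ fun n => hC.evalPow X n Y

theorem evalHom_lof {X Y : C} (n : ℕ) (t : (tensorPow K X n).obj Y) :
    hC.evalHom X Y (DirectSum.lof K ℕ (fun n => (tensorPow K X n).obj Y) n t) =
      hC.evalPow X n Y t :=
  DirectSum.toModule_lof _ _ _

theorem evalHom_actC (X : C) {Y Z : C} (g : Y ⟶ Z) (s : TensorHom K X Y) :
    hC.evalHom X Z (actC X g s) = hC.evalHom X Y s ≫ homProj K Y Z 0 g := by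
  have : (hC.evalHom X Z).comp (actC X g) =
      (Linear.rightComp K X (homProj K Y Z 0 g)).comp (hC.evalHom X Y) := by
    refine DirectSum.linearMap_ext K fun n => LinearMap.ext fun t => ?_
    simp only [LinearMap.comp_apply, actC_lof, evalHom_lof, evalPow_map, Linear.rightComp_apply]
  exact LinearMap.congr_fun this s

theorem evalHom_actR (X : C) {Y Z : C} (r : RadQuot K Y Z) (s : TensorHom K X Y) :
    hC.evalHom X Z (actR X r s) = hC.evalHom X Y s ≫ hC.evalRadQuot Y Z r := by
  have : (hC.evalHom X Z).comp (actR X r) =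
      (Linear.rightComp K X (hC.evalRadQuot Y Z r)).comp (hC.evalHom X Y) := by
    refine DirectSum.linearMap_ext K fun n => LinearMap.ext fun t => ?_
    simp only [LinearMap.comp_apply, actR_lof, evalHom_lof, evalPow_tens, Linear.rightComp_apply]
  exact LinearMap.congr_fun this s

theorem evalHom_tensorId (X : C) : hC.evalHom X X (tensorId X) = 𝟙 X := by
  rw [tensorId, evalHom_lof, evalPow_ofHom, homProj_of_mem (GradedCategory.id_mem X)]

/-- Induction on the outer morphism `t`, peeling off its last tensor factor; associativity in `C`
matches the recursive definition of composition in `T(C)`. -/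
theorem evalHom_compHom {X Y Z : C} (t : TensorHom K Y Z) (s : TensorHom K X Y) :
    hC.evalHom X Z (compHom t s) = hC.evalHom X Y s ≫ hC.evalHom Y Z t := by
  refine tensorHom_induction (X := Y) (fun Z => LinearMap.eqLocus
    ((hC.evalHom X Z).comp (compHom.flip s))
    ((Linear.leftComp K Z (hC.evalHom X Y s)).comp (hC.evalHom Y Z))) ?_ ?_ t
  · intro Z g
    refine LinearMap.mem_eqLocus.2 ?_
    rw [LinearMap.comp_apply, LinearMap.comp_apply, LinearMap.flip_apply, Linear.leftComp_apply]
    rw [compHom_lof_zero, evalHom_actC, evalHom_lof, evalPow_ofHom]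
  · intro Z W r n t ht
    refine LinearMap.mem_eqLocus.2 ?_
    replace ht := LinearMap.mem_eqLocus.1 ht
    rw [LinearMap.comp_apply, LinearMap.comp_apply, LinearMap.flip_apply,
      Linear.leftComp_apply] at ht ⊢
    rw [compHom_lof_succ, evalHom_actR, ht, evalHom_lof, evalHom_lof, evalPow_tens,
      Category.assoc]

/-- The evaluation functor `T(C) ⥤ C`. -/
def eval : FreeTensor K C ⥤ C where
  obj X := X.as
  map {X Y} s := hC.evalHom X.as Y.as s
  map_id X := hC.evalHom_tensorId X.as
  map_comp s t := hC.evalHom_compHom t s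

/-- Tensors of degree `n` evaluate to morphisms of degree `n`, so different degrees cannot cancel.
This makes the kernel of evaluation a graded ideal. -/
theorem homProj_evalHom {X Y : C} (n : ℕ) (s : TensorHom K X Y) :
    homProj K X Y n (hC.evalHom X Y s) = hC.evalPow X n Y (s n) := by
  have : (homProj K X Y n).comp (hC.evalHom X Y) =
      (hC.evalPow X n Y).comp (DirectSum.component K ℕ (fun n => (tensorPow K X n).obj Y) n) := by
    refine DirectSum.linearMap_ext K fun m => LinearMap.ext fun t => ?_
    simp only [LinearMap.comp_apply, evalHom_lof]
    rw [DirectSum.component.of]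
    split_ifs with h
    · subst h
      exact homProj_of_mem (hC.evalPow_mem X m t)
    · rw [map_zero]
      exact homProj_of_mem_of_ne (hC.evalPow_mem X m t) (by exact_mod_cast h)
  exact LinearMap.congr_fun this s

/-- The kernel of the evaluation functor `T(C) ⥤ C`. -/
def relations : GradedIdeal K (FreeTensor K C) where
  carrier X Y := LinearMap.ker (hC.evalHom X.as Y.as)
  precomp_mem {X Y Z} h {f} hf := by
    change hC.eval.map (h ≫ f) = 0
    rw [Functor.map_comp, show hC.eval.map f = 0 from hf, Limits.comp_zero]
  postcomp_mem {X Y Z f} h hf := by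
    change hC.eval.map (f ≫ h) = 0
    rw [Functor.map_comp, show hC.eval.map f = 0 from hf, Limits.zero_comp]
  homogeneous X Y := by
    classical
    intro s hs
    rw [LinearMap.mem_ker] at hs
    change TensorHom K X.as Y.as at s
    rw [← DirectSum.sum_support_of s]
    refine Submodule.sum_mem _ fun n _ => Submodule.mem_iSup_of_mem (n : ℤ) ⟨?_, ⟨s n, rfl⟩⟩
    refine (hC.evalHom_lof n (s n)).trans ?_
    rw [← homProj_evalHom, hs, map_zero]

theorem mem_relations {X Y : FreeTensor K C} {s : X ⟶ Y} :
    s ∈ hC.relations.carrier X Y ↔ hC.eval.map s = 0 := Iff.rfl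

end IsKoszul

end Evaluation

/-! ### Fullness of the evaluation and generation of the relations in degree two -/

section Quadratic

variable {K : Type w} [Field K] {C : Type u} [Category.{v} C] [Preadditive C] [Linear K C]
  [GradedCategory K C]

/-- Additivity of `tensorPow X n` recovers a tensor from its components at the summands of `Y`,
which reduces questions to targets with local endomorphism ring. -/
theorem tensorPow_eq_sum (X : C) (n : ℕ) {Y : C} {k : ℕ} {Y' : Fin k → C} {ι : ∀ a, Y' a ⟶ Y}
    {π : ∀ a, Y ⟶ Y' a} (h : ∑ a, π a ≫ ι a = 𝟙 Y) (t : (tensorPow K X n).obj Y) :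
    ∑ a, ((tensorPow K X n).map (ι a)).hom (((tensorPow K X n).map (π a)).hom t) = t := by
  let φ : (Y ⟶ Y) →+ (tensorPow K X n).obj Y := AddMonoidHom.mk'
    (fun g => ((tensorPow K X n).map g).hom t) fun g g' => by rw [map_add_tensorPow]; rfl
  calc _ = ∑ a, φ (π a ≫ ι a) := Finset.sum_congr rfl fun a _ => by
        change _ = ((tensorPow K X n).map (π a ≫ ι a)).hom t
        rw [Functor.map_comp]; rfl
    _ = φ (𝟙 Y) := by rw [← map_sum, h]
    _ = t := by
        change ((tensorPow K X n).map (𝟙 Y)).hom t = t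
        rw [CategoryTheory.Functor.map_id]; rfl

/-- For a radical `f = g ≫ d`, the balancing relation moves `g` across the tensor sign: the tensor
of `f` with `s` equals that of `d` with `g` acting on `s`. Since `d` is fixed, sums of such tensors
again have this form. -/
theorem exists_tens_mk_eq (X : C) (n : ℕ) {P Y : C} {d : P ⟶ Y}
    (hd : d ∈ (radical K C).carrier P Y)
    (h : ∀ (Z : C) (f : Z ⟶ Y), f ∈ (radical K C).carrier Z Y → ∃ g, g ≫ d = f)
    (t : (tensorPow K X (n + 1)).obj Y) : ∃ t', tens X n (RadQuot.mk d hd) t' = t := by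
  have h0 : (LinearMap.range (tens X n (RadQuot.mk d hd))).mkQ = 0 := by
    refine tens_ext X n fun Z r s => (Submodule.Quotient.mk_eq_zero _).2 ?_
    induction r using RadQuot.ind with
    | h f hf =>
      obtain ⟨g, rfl⟩ := h Z f hf
      exact ⟨((tensorPow K X n).map g).hom s,
        by rw [← tens_pre, RadQuot.pre_mk]⟩
  exact (Submodule.Quotient.mk_eq_zero _).1 (LinearMap.congr_fun h0 t)

namespace IsKoszul

variable (hC : IsKoszul K C)

/-- Positive degree morphisms are radical, so into a local summand they factor through `d₀`. The
other factor can be cut down to its degree `n` component and treated by induction. -/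
theorem exists_evalPow_eq (X : C) (n : ℕ) {Y : C} {f : X ⟶ Y} (hf : f ∈ homDeg K X Y n) :
    ∃ t, hC.evalPow X n Y t = f := by
  have hpos := hC.isPositivelyGraded
  induction n generalizing Y with
  | zero => exact ⟨ofHom X Y f, by rw [evalPow_ofHom]; exact homProj_of_mem hf⟩
  | succ n ih =>
    obtain ⟨k, Y', ⟨ι, π, hι, hπ, -, -, hsum⟩, hloc⟩ := hC.krullSchmidt Y
    have key : ∀ a, ∃ t, hC.evalPow X (n + 1) (Y' a) t = f ≫ π a := by
      intro a
      obtain ⟨P₁, -, d₀, -, hd₀, -, -, h, -⟩ := hC.exists_presentation (hloc a)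
      have hfa : f ≫ π a ∈ homDeg K X (Y' a) (n + 1 : ℕ) :=
        comp_mem_of_eq hf (hπ a) (add_zero _)
      obtain ⟨g, hg⟩ := h X (f ≫ π a) (hpos.mem_radical_of_mem (by omega) hfa)
      obtain ⟨t, ht⟩ := ih (homProj_mem (n : ℤ) g)
      refine ⟨tens X n (RadQuot.mk d₀ (hpos.mem_radical_of_mem one_ne_zero hd₀)) t, ?_⟩
      rw [evalPow_tens, evalRadQuot_mk, homProj_of_mem hd₀, ht,
        ← homProj_comp_of_mem g hd₀ (k := (n + 1 : ℕ)) (by push_cast; rfl), hg,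
        homProj_of_mem hfa]
    choose t ht using key
    refine ⟨∑ a, ((tensorPow K X (n + 1)).map (ι a)).hom (t a), ?_⟩
    simp only [map_sum, evalPow_map, ht, homProj_of_mem (hι _), Category.assoc]
    rw [← Preadditive.comp_sum, hsum, Category.comp_id]

theorem evalHom_surjective (X Y : C) : Function.Surjective (hC.evalHom X Y) := by
  intro f
  refine hom_induction (K := K) (p := fun f => ∃ s, hC.evalHom X Y s = f) ⟨0, map_zero _⟩ ?_ ?_ f
  · rintro _ _ ⟨s, rfl⟩ ⟨t, rfl⟩
    exact ⟨s + t, map_add _ s t⟩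
  · rintro (n | n) f hf
    · obtain ⟨t, ht⟩ := hC.exists_evalPow_eq X n hf
      exact ⟨_, (hC.evalHom_lof n t).trans ht⟩
    · rw [hC.positivelyGraded X Y _ (Int.negSucc_lt_zero n), Submodule.mem_bot] at hf
      exact ⟨0, by rw [map_zero, hf]⟩

/-- Induction on the tensor degree, using that `d₁` is a weak kernel of `d₀`: modulo the quadratic
relation `d₀ ⊗ d₁`, a relation `d₀ ⊗ t'` reduces to `d₀` composed with a relation of lower degree.
-/
theorem lof_mem_of_evalPow_eq_zero (J : LinearIdeal K (FreeTensor K C))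
    (hJ : ∀ (X Y : C) (t : (tensorPow K X 2).obj Y), hC.evalPow X 2 Y t = 0 →
      DirectSum.lof K ℕ (fun n => (tensorPow K X n).obj Y) 2 t ∈ J.carrier ⟨X⟩ ⟨Y⟩)
    (X : C) (n : ℕ) {Y : C} (t : (tensorPow K X n).obj Y) (ht : hC.evalPow X n Y t = 0) :
    DirectSum.lof K ℕ (fun n => (tensorPow K X n).obj Y) n t ∈ J.carrier ⟨X⟩ ⟨Y⟩ := by
  have hpos := hC.isPositivelyGraded
  induction n generalizing Y with
  | zero =>
    obtain ⟨f, rfl⟩ := ofHom_surjective X Y t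
    rw [ofHom_eq_zero (hC.mem_radical_iff.2 ht), map_zero]
    exact Submodule.zero_mem _
  | succ n ih =>
    obtain ⟨k, Y', ⟨ι, π, -, -, -, -, hsum⟩, hloc⟩ := hC.krullSchmidt Y
    have key : ∀ a, DirectSum.lof K ℕ (fun n => (tensorPow K X n).obj (Y' a)) (n + 1)
        (((tensorPow K X (n + 1)).map (π a)).hom t) ∈ J.carrier ⟨X⟩ ⟨Y' a⟩ := by
      intro a
      obtain ⟨P₁, P₂, d₀, d₁, hd₀, hd₁, hd, h, h'⟩ := hC.exists_presentation (hloc a)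
      have hr₀ := hpos.mem_radical_of_mem one_ne_zero hd₀
      have hr₁ := hpos.mem_radical_of_mem one_ne_zero hd₁
      have hta : hC.evalPow X (n + 1) (Y' a) (((tensorPow K X (n + 1)).map (π a)).hom t) = 0 := by
        rw [evalPow_map, ht, Limits.zero_comp]
      generalize ((tensorPow K X (n + 1)).map (π a)).hom t = ta at hta
      obtain ⟨t', rfl⟩ := exists_tens_mk_eq X n hr₀ h ta
      rw [evalPow_tens, evalRadQuot_mk, homProj_of_mem hd₀] at hta
      obtain ⟨g, hg⟩ := h' X _ hta
      -- The subtraction takes place in `ℤ`, so for `n = 0` the component of `g` has degree `-1`.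
      have hg' : hC.evalPow X n P₁ t' = homProj K X P₂ (n - 1) g ≫ d₁ := by
        rw [← homProj_comp_of_mem g hd₁ (sub_add_cancel (n : ℤ) 1), hg,
          homProj_of_mem (hC.evalPow_mem X n t')]
      -- In tensor degree one that component vanishes, so `t'` is already zero: there are no
      -- nontrivial linear relations.
      obtain _ | n := n
      · rw [hpos.homProj_eq_zero (by norm_num), Limits.zero_comp] at hg'
        obtain ⟨f, rfl⟩ := ofHom_surjective X P₁ t'
        rw [ofHom_eq_zero (hC.mem_radical_iff.2 hg'), map_zero, map_zero]
        exact Submodule.zero_mem _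
      · rw [show ((n + 1 : ℕ) : ℤ) - 1 = n by push_cast; ring] at hg'
        obtain ⟨s, hs⟩ := hC.exists_evalPow_eq X n (homProj_mem (n : ℤ) g)
        have hsub : hC.evalPow X (n + 1) P₁ (t' - tens X n (RadQuot.mk d₁ hr₁) s) = 0 := by
          rw [map_sub, evalPow_tens, evalRadQuot_mk, homProj_of_mem hd₁, hs, hg', sub_self]
        -- `J` is closed under composition in `T(C)`, so `d₀` and `d₀ ⊗ d₁` are realised as
        -- morphisms there by tensoring with an identity on the right.
        let e₀ : (⟨P₁⟩ : FreeTensor K C) ⟶ ⟨Y' a⟩ :=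
          DirectSum.lof K ℕ (fun n => (tensorPow K P₁ n).obj (Y' a)) 1
            (tens P₁ 0 (RadQuot.mk d₀ hr₀) (ofHom P₁ P₁ (𝟙 P₁)))
        let e : (⟨P₂⟩ : FreeTensor K C) ⟶ ⟨Y' a⟩ :=
          DirectSum.lof K ℕ (fun n => (tensorPow K P₂ n).obj (Y' a)) 2
            (tens P₂ 1 (RadQuot.mk d₀ hr₀) (tens P₂ 0 (RadQuot.mk d₁ hr₁)
              (ofHom P₂ P₂ (𝟙 P₂))))
        have he : e ∈ J.carrier _ _ := hJ _ _ _ (by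
          simp only [evalPow_tens, evalRadQuot_mk, evalPow_ofHom, homProj_of_mem hd₀,
            homProj_of_mem hd₁, homProj_of_mem (GradedCategory.id_mem (K := K) P₂),
            Category.id_comp, hd])
        have h1 := J.postcomp_mem e₀ (ih _ hsub)
        let s' : (⟨X⟩ : FreeTensor K C) ⟶ ⟨P₂⟩ :=
          DirectSum.lof K ℕ (fun n => (tensorPow K X n).obj P₂) n s
        have h2 := J.precomp_mem s' he
        -- The decomposition `d₀ ⊗ t' = d₀ ⊗ (t' - d₁ ⊗ s) + (d₀ ⊗ d₁) ⊗ s`.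
        refine (congrArg (· ∈ J.carrier _ _) ?_).mpr (Submodule.add_mem _ h1 h2)
        have h4 : ∀ x : (⟨X⟩ : FreeTensor K C) ⟶ ⟨P₁⟩,
            x ≫ e₀ = actR X (RadQuot.mk d₀ hr₀) x := by
          intro x
          refine (compHom_lof_succ 0 _ _ x).trans ?_
          rw [compHom_lof_zero, actC_id]
        have h5 : s' ≫ e = actR X (RadQuot.mk d₀ hr₀) (actR X (RadQuot.mk d₁ hr₁) s') := by
          refine (compHom_lof_succ 1 _ _ s').trans ?_
          rw [compHom_lof_succ, compHom_lof_zero, actC_id]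
        rw [h4, h5, actR_lof, actR_lof, actR_lof]
        refine ((map_add _ _ _).symm.trans (congrArg _ ?_)).symm
        rw [← map_add, sub_add_cancel]
    -- The inclusions of the summands act as degree zero morphisms of `T(C)`, so reassembling the
    -- components stays inside `J`.
    rw [← tensorPow_eq_sum X (n + 1) hsum t, map_sum]
    refine Submodule.sum_mem _ fun a _ => ?_
    have := J.postcomp_mem (show (⟨Y' a⟩ : FreeTensor K C) ⟶ ⟨Y⟩ from
      DirectSum.lof K ℕ (fun n => (tensorPow K (Y' a) n).obj Y) 0 (ofHom (Y' a) Y (ι a))) (key a)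
    have h1 : _ = _ := compHom_lof_zero (X := X) (ι a)
      (DirectSum.lof K ℕ (fun n => (tensorPow K X n).obj (Y' a)) (n + 1)
        (((tensorPow K X (n + 1)).map (π a)).hom t))
    rw [actC_lof] at h1
    rw [← h1]
    exact this

theorem relations_generatedInDegree_two : hC.relations.GeneratedInDegree 2 := by
  intro J hJ X Y
  refine (hC.relations.homogeneous X Y).trans (iSup_le fun i => ?_)
  rintro s ⟨hs, hsi⟩
  rcases i with n | n
  · obtain ⟨t, rfl⟩ := hsi
    refine hC.lof_mem_of_evalPow_eq_zero J.toLinearIdeal (fun X Y t ht => hJ _ _ ⟨?_, ⟨t, rfl⟩⟩)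
      X.as n t ((hC.evalHom_lof n t).symm.trans hs)
    exact (hC.evalHom_lof 2 t).trans ht
  · rw [(Submodule.mem_bot K).1 hsi]
    exact Submodule.zero_mem _

/-! ### The equivalence between the category and its quadratic presentation -/

theorem eval_map_eq_iff {X Y : FreeTensor K C} (s t : X ⟶ Y) :
    hC.relations.rel s t ↔ hC.eval.map s = hC.eval.map t := by
  refine hC.mem_relations.trans ?_
  rw [← sub_eq_zero (a := hC.eval.map s)]
  exact Eq.congr_left (map_sub (hC.evalHom X.as Y.as) s t)

/-- The functor `T(C) / I ⥤ C` induced by the evaluation. -/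
noncomputable def quotientEval : hC.relations.QuotientCategory ⥤ C :=
  CategoryTheory.Quotient.lift _ hC.eval fun _ _ s t h => (hC.eval_map_eq_iff s t).1 h

theorem quotientEval_bijective (X Y : hC.relations.QuotientCategory) :
    Function.Bijective (hC.quotientEval.map (X := X) (Y := Y)) := by
  constructor
  · intro f g hfg
    obtain ⟨s, rfl⟩ := hC.relations.proj.map_surjective f
    obtain ⟨t, rfl⟩ := hC.relations.proj.map_surjective g
    exact CategoryTheory.Quotient.sound _ ((hC.eval_map_eq_iff s t).2 hfg)
  · intro f
    obtain ⟨s, rfl⟩ := hC.evalHom_surjective X.as.as Y.as.as f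
    exact ⟨hC.relations.proj.map s, rfl⟩

theorem isGradedFunctor_quotientEval : IsGradedFunctor K hC.quotientEval where
  map_add {X Y} f g := by
    obtain ⟨s, rfl⟩ := hC.relations.proj.map_surjective f
    obtain ⟨t, rfl⟩ := hC.relations.proj.map_surjective g
    exact map_add (hC.evalHom X.as.as Y.as.as) s t
  map_smul {X Y} c f := by
    obtain ⟨s, rfl⟩ := hC.relations.proj.map_surjective f
    exact map_smul (hC.evalHom X.as.as Y.as.as) c s
  map_mem {X Y i f} hf := by
    obtain ⟨s, hs, rfl⟩ := hf
    rcases i with n | n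
    · obtain ⟨t, rfl⟩ := hs
      have : hC.evalHom X.as.as Y.as.as _ ∈ homDeg K X.as.as Y.as.as n :=
        (congrArg (· ∈ homDeg K X.as.as Y.as.as n) (hC.evalHom_lof n t)).mpr
          (hC.evalPow_mem X.as.as n t)
      exact this
    · rw [(Submodule.mem_bot K).1 hs, map_zero]
      have : hC.evalHom X.as.as Y.as.as 0 ∈ homDeg K X.as.as Y.as.as (Int.negSucc n) := by
        rw [map_zero]; exact Submodule.zero_mem _
      exact this

/-- The functor `C ⥤ T(C) / I` inverse to the evaluation. -/
noncomputable def quotientSection : C ⥤ hC.relations.QuotientCategory where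
  obj X := ⟨⟨X⟩⟩
  -- The preimage is unique, so functoriality follows by comparing values under the faithful functor
  -- `quotientEval`.
  map {X Y} f := ((hC.quotientEval_bijective ⟨⟨X⟩⟩ ⟨⟨Y⟩⟩).2 f).choose
  map_id X := (hC.quotientEval_bijective _ _).1 <|
    ((hC.quotientEval_bijective ⟨⟨X⟩⟩ ⟨⟨X⟩⟩).2 (𝟙 X)).choose_spec.trans
      (hC.quotientEval.map_id ⟨⟨X⟩⟩).symm
  map_comp {X Y Z} f g := (hC.quotientEval_bijective _ _).1 <|
    ((hC.quotientEval_bijective ⟨⟨X⟩⟩ ⟨⟨Z⟩⟩).2 (f ≫ g)).choose_spec.trans <| by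
      refine Eq.trans ?_ (hC.quotientEval.map_comp _ _).symm
      exact (congrArg₂ (fun (a : X ⟶ Y) (b : Y ⟶ Z) => a ≫ b)
        ((hC.quotientEval_bijective ⟨⟨X⟩⟩ ⟨⟨Y⟩⟩).2 f).choose_spec
        ((hC.quotientEval_bijective ⟨⟨Y⟩⟩ ⟨⟨Z⟩⟩).2 g).choose_spec).symm

theorem quotientEval_quotientSection_map {X Y : C} (f : X ⟶ Y) :
    hC.quotientEval.map (hC.quotientSection.map f) = f :=
  ((hC.quotientEval_bijective ⟨⟨X⟩⟩ ⟨⟨Y⟩⟩).2 f).choose_spec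

theorem isGradedFunctor_quotientSection : IsGradedFunctor K hC.quotientSection where
  map_add f g := (hC.quotientEval_bijective _ _).1 <| by
    rw [hC.isGradedFunctor_quotientEval.map_add]
    simp only [quotientEval_quotientSection_map]
    rfl
  map_smul c f := (hC.quotientEval_bijective _ _).1 <| by
    rw [hC.isGradedFunctor_quotientEval.map_smul]
    simp only [quotientEval_quotientSection_map]
    rfl
  map_mem {X Y i f} hf := by
    rcases i with n | n
    -- Evaluation is surjective in each degree separately, so the preimage of a homogeneous morphism
    -- is homogeneous of the same degree.
    · obtain ⟨t, ht⟩ := hC.exists_evalPow_eq X n hf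
      refine ⟨DirectSum.lof K ℕ (fun n => (tensorPow K X n).obj Y) n t, ⟨t, rfl⟩,
        (hC.quotientEval_bijective _ _).1 ?_⟩
      rw [quotientEval_quotientSection_map]
      exact (hC.evalHom_lof n t).trans ht
    · rw [hC.positivelyGraded X Y _ (Int.negSucc_lt_zero n), Submodule.mem_bot] at hf
      have : hC.quotientSection.map f = 0 := (hC.quotientEval_bijective _ _).1 <| by
        rw [quotientEval_quotientSection_map, hf]
        exact (map_zero (hC.evalHom X Y)).symm
      rw [this]
      exact Submodule.zero_mem _

/-- The equivalence between a Koszul category and its quadratic presentation. -/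
noncomputable def quotientEquivalence : C ≌ hC.relations.QuotientCategory where
  functor := hC.quotientSection
  inverse := hC.quotientEval
  unitIso := NatIso.ofComponents (fun X => (Iso.refl X : X ≅ X)) fun {X Y} f =>
    (Category.comp_id f).trans
      ((hC.quotientEval_quotientSection_map f).symm.trans
        (Category.id_comp (X := X) (Y := Y) _).symm)
  counitIso := NatIso.ofComponents (fun X => (Iso.refl X : X ≅ X)) fun {X Y} f =>
    (Category.comp_id (X := X) (Y := Y) _).trans
      (((hC.quotientEval_bijective X Y).1
        (hC.quotientEval_quotientSection_map (hC.quotientEval.map f))).trans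
          (Category.id_comp f).symm)
  functor_unitIso_comp X := (congrArg (· ≫ 𝟙 _) (hC.quotientSection.map_id X)).trans
    (Category.comp_id _)

end IsKoszul

end Quadratic

end KoszulCategory

theorem mainTheorem6 (K : Type w) [Field K] (C : Type u) [Category.{v} C] [Preadditive C]
    [Linear K C] [KoszulCategory.GradedCategory K C] (hC : KoszulCategory.IsKoszul K C) :
    ∃ I : KoszulCategory.GradedIdeal K (KoszulCategory.FreeTensor K C),
      I.GeneratedInDegree 2 ∧ KoszulCategory.GradedEquivalent K C I.QuotientCategory := by
  refine ⟨hC.relations, hC.relations_generatedInDegree_two, hC.quotientEquivalence,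
    hC.isGradedFunctor_quotientSection, hC.isGradedFunctor_quotientEval, ?_, ?_⟩
  -- The components of the unit and the counit are identities, since both functors are the identity
  -- on underlying objects.
  · exact fun X => KoszulCategory.GradedCategory.id_mem X
  · exact fun Y => KoszulCategory.GradedCategory.id_mem Y
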